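/- **Setting.** Let $L_2=\mathbb Z/2\wr\mathbb Z$ be the lamplighter group, with $t$ the generator of $\mathbb Z$ and $a$ the generator of $\mathbb Z/2$; let $\exp_t:L_2\to\mathbb Z$ be the homomorphism with $a\mapsto0$, $t\mapsto1$. An element of $L_2$ is a lamp stand: finitely many lit lamps in a row indexed by $\mathbb Z$, and a position of the lamplighter. Let $T_0,T_1$ be copies of the $3$-valent tree, oriented so that each vertex has one predecessor and two successors, with height functions $h_i$ and with distinguished ends $\omega_i$, the ends reached by following predecessors. The Diestel–Leader graph $\mathrm{DL}_2(2)$ has as vertices the pairs $(x_0,x_1)$ with $h_0(x_0)+h_1(x_1)=0$; two of them are adjacent if both coordinates are. It is the Cayley graph of $L_2$ with respect to $\{t,at\}$: the lamplighter is at position $h_0(x_0)$, the lamps at smaller positions are encoded by $x_0$ and the other ones by $x_1$. So $L_2$ acts on $\mathrm{DL}_2(2)$ by left multiplication. Let $\partial\mathrm{DL}_2(2)$ be the set of asymptotic classes of geodesic rays of $\mathrm{DL}_2(2)$, with the induced action of $L_2$ and with the *unbased* topology: the quotient topology from the space of all geodesic rays with the topology of uniform convergence on compact sets. Every class contains rays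 from every vertex $p$; the quotient topology on the same set from the space of the rays emanating from $p$ is called the topology *based at $p$*. As a set, $\partial\mathrm{DL}_2(2)$ is the disjoint union of $\partial_+=(\partial T_0-\omega_0)\times\{\omega_1\}$ and $\partial_-=(\partial T_1-\omega_1)\times\{\omega_0\}$, according to the ends that the projections of a ray approach. A class has a lamp stand, the limit of the lamp stands along a ray, with the lamplighter at $+\infty$ (on $\partial_+$) or $-\infty$ (on $\partial_-$). If $\exp_t(g)\ne0$, then $g^{\infty}$ denotes the class whose lamps are the pointwise limit of those of $g^n$ as $n\to\infty$, with the lamplighter at $+\infty$ if $\exp_t(g)>0$ and at $-\infty$ if $\exp_t(g)<0$; and $g^{-\infty}=(g^{-1})^\infty$. For a topology on $\partial\mathrm{DL}_2(2)$, *$g$ acts with north-south dynamics with attractor $\alpha$ and repeller $\rho$* means: $\alpha\neq\rho$ are fixed by $g$; $g^n\xi\to\alpha$ for every $\xi\ne\rho$, and $g^{-n}\xi\to\rho$ for every $\xi\neq\alpha$, as $n\to\infty$; and for all open $U\ni\alpha$ and $V\ni\rho$ there is $N$ such that $g^n(V^c)\subseteq U$ and $g^{-n}(U^c)\subseteq V$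 for all $n\ge N$. (Limits need not be unique, as these topologies are not Hausdorff.) **Theorem.** Let $g\in L_2$ be nontrivial. 1. If $\exp_t(g)=0$, then $g$ acts on $\partial\mathrm{DL}_2(2)$ as a permutation of order $2$, and every point has minimal period $2$. 2. If $\exp_t(g)\neq0$, then $g^{\infty}$ and $g^{-\infty}$ are well defined (exactly one class each), and $g$ acts on $\partial\mathrm{DL}_2(2)$ (unbased topology) with north-south dynamics with attractor $g^\infty$ and repeller $g^{-\infty}$. If $\exp_t(g)>0$, then $g^\infty\in\partial_+$ and $g^{-\infty}\in\partial_-$; if $\exp_t(g)<0$, then $g^\infty\in\partial_-$ and $g^{-\infty}\in\partial_+$. 3. If $\exp_t(g)\ne0$, the following holds for the based topologies. For every vertex $p$, in the topology based at $p$, $g^n\xi\to g^\infty$ for every $\xi$ in the one of $\partial_\pm$ that contains $g^\infty$, and $g^{-n}\xi\to g^{-\infty}$ for every $\xi$ in the one that contains $g^{-\infty}$. Moreover $g$ acts with north-south dynamics with attractor $g^\infty$ and repeller $g^{-\infty}$ for the topology based at $p$ if and only if $g^{\infty}$ and $g^{-\infty}$ are both represented by rays from $p$ along which the heights are monotone,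 and there is a vertex $p$ (depending on $g$) with this property. -/

import Mathlib

open Filter Topology

noncomputable section

/-! ### Visual boundaries of graphs -/

section VisualBoundary

variable {V W : Type*}

/-- Geodesic rays issuing from vertices of a graph, recorded by the sequence of vertices through
which they pass. -/
def GeodRay (G : SimpleGraph V) : Type _ :=
  {γ : ℕ → V // ∀ m n : ℕ, m ≤ n → G.edist (γ m) (γ n) = ((n - m : ℕ) : ℕ∞)}

instance (G : SimpleGraph V) : CoeFun (GeodRay G) (fun _ => ℕ → V) := ⟨Subtype.val⟩

/-- Two rays are asymptotic if they stay at bounded distance from each other. -/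
def GeodRay.asymptotic (G : SimpleGraph V) : Setoid (GeodRay G) where
  r γ γ' := ∃ C : ℕ, ∀ n : ℕ, G.edist (γ n) (γ' n) ≤ (C : ℕ∞)
  iseqv :=
    { refl := fun γ => ⟨0, fun n => by simp⟩
      symm := fun {γ γ'} ⟨C, h⟩ => ⟨C, fun n => by rw [SimpleGraph.edist_comm]; exact h n⟩
      trans := fun {γ γ' γ''} ⟨C, h⟩ ⟨D, h'⟩ => ⟨C + D, fun n => by
        push_cast
        exact SimpleGraph.edist_triangle.trans (add_le_add (h n) (h' n))⟩ }

/-- The topology of uniform convergence on compact sets on the set of rays. As rays are recorded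
by their vertices and distinct vertices have distance at least `1`, this is the topology of
pointwise convergence, where the set of vertices is discrete: two rays are close if they share a
long initial segment. -/
instance (G : SimpleGraph V) : TopologicalSpace (GeodRay G) :=
  TopologicalSpace.induced (fun γ : GeodRay G => (γ : ℕ → V))
    (@Pi.topologicalSpace ℕ (fun _ => V) (fun _ => ⊥))

/-- The set of asymptotic classes of geodesic rays. -/
def VisualBoundary (G : SimpleGraph V) : Type _ := Quotient (GeodRay.asymptotic G)

/-- The asymptotic class of a ray. -/
def GeodRay.cls {G : SimpleGraph V} (γ : GeodRay G) : VisualBoundary G :=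
  Quotient.mk (GeodRay.asymptotic G) γ

/-- The topology of the (unbased) visual boundary: the quotient topology from the space of all
geodesic rays. -/
instance VisualBoundary.unbased (G : SimpleGraph V) : TopologicalSpace (VisualBoundary G) :=
  TopologicalSpace.coinduced (fun γ : GeodRay G => γ.cls) inferInstance

/-- The topology of the visual boundary based at `p`: the quotient topology from the space of the
geodesic rays emanating from `p` (meaningful if every class contains such a ray). -/
@[reducible] def VisualBoundary.based (G : SimpleGraph V) (p : V) : TopologicalSpace (VisualBoundary G) :=
  TopologicalSpace.coinduced (fun γ : {γ : GeodRay G // γ 0 = p} => γ.1.cls) inferInstance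

theorem edist_map_le {G : SimpleGraph V} {G' : SimpleGraph W} (f : G →g G') (u v : V) :
    G'.edist (f u) (f v) ≤ G.edist u v := by
  by_cases h : G.edist u v = ⊤
  · simp [h]
  · obtain ⟨w, hw⟩ := SimpleGraph.exists_walk_of_edist_ne_top h
    rw [← hw, ← SimpleGraph.Walk.length_map f w]
    exact SimpleGraph.edist_le _

theorem edist_map_iso {G : SimpleGraph V} {G' : SimpleGraph W} (f : G ≃g G') (u v : V) :
    G'.edist (f u) (f v) = G.edist u v := by
  apply le_antisymm (edist_map_le f.toHom u v)
  simpa using edist_map_le f.symm.toHom (f u) (f v)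

/-- The image of a ray under an automorphism of the graph. -/
def GeodRay.map {G : SimpleGraph V} (f : G ≃g G) (γ : GeodRay G) : GeodRay G :=
  ⟨fun n => f (γ n), fun m n h => by rw [edist_map_iso]; exact γ.2 m n h⟩

/-- The induced map on asymptotic classes. -/
def VisualBoundary.map {G : SimpleGraph V} (f : G ≃g G) : VisualBoundary G → VisualBoundary G :=
  Quotient.map (sa := GeodRay.asymptotic G) (sb := GeodRay.asymptotic G) (GeodRay.map f)
    (fun γ γ' ⟨C, h⟩ => ⟨C, fun n => by
      change G.edist (f (γ n)) (f (γ' n)) ≤ _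
      rw [edist_map_iso]; exact h n⟩)

end VisualBoundary

/-! ### The 3-valent tree with a distinguished end -/

/-- A vertex of the `3`-valent tree `T` in which each vertex has one predecessor and two
successors. A vertex of height `k` is recorded by the labels in `ℤ/2` of the edges of the path
that leads to it from the distinguished end `ω`: `label i` is the label of the edge from height
`i` to height `i + 1` (for `i < k`), all but finitely many of them are `0`, and the two edges
from a vertex to its successors have different labels. -/
@[ext] structure TreeVertex where
  height : ℤ
  label : ℤ →₀ ZMod 2
  label_eq_zero : ∀ i, height ≤ i → label i = 0

namespace TreeVertex

/-- The predecessor of a vertex: forget the last label. -/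
def pred (v : TreeVertex) : TreeVertex where
  height := v.height - 1
  label := v.label.erase (v.height - 1)
  label_eq_zero i hi := by
    by_cases h : i = v.height - 1
    · simp [h]
    · rw [Finsupp.erase_ne h]
      exact v.label_eq_zero i (by omega)

theorem height_pred (v : TreeVertex) : v.pred.height = v.height - 1 := rfl

/-- The vertex of height `k` on the line from `ω` all of whose labels are `0`; the base vertex of
the tree is `zero 0`. -/
def zero (k : ℤ) : TreeVertex := ⟨k, 0, fun _ _ => rfl⟩

theorem pred_zero (k : ℤ) : (zero k).pred = zero (k - 1) := by
  ext <;> simp [zero, pred]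

end TreeVertex

/-- The tree: each vertex is joined to its predecessor and to its successors. -/
def tree : SimpleGraph TreeVertex where
  Adj v w := v = w.pred ∨ w = v.pred
  symm := ⟨fun _ _ h => h.symm⟩
  loopless := ⟨fun v h => by
    have h1 : v = v.pred := by tauto
    have h2 := congrArg TreeVertex.height h1
    rw [TreeVertex.height_pred] at h2
    omega⟩

theorem tree_walk_height {v w : TreeVertex} (p : tree.Walk v w) :
    v.height - w.height ≤ p.length := by
  induction p with
  | nil => simp
  | cons h p ih =>
    rw [SimpleGraph.Walk.length_cons]
    push_cast
    rcases h with h | h <;>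
      · have hh := congrArg TreeVertex.height h
        rw [TreeVertex.height_pred] at hh
        omega

theorem tree_walk_down (k : ℤ) (n : ℕ) :
    ∃ p : tree.Walk (TreeVertex.zero k) (TreeVertex.zero (k - n)), p.length = n := by
  induction n with
  | zero => exact ⟨SimpleGraph.Walk.nil.copy rfl (by simp), by simp⟩
  | succ n ih =>
    obtain ⟨p, hp⟩ := ih
    have h : tree.Adj (TreeVertex.zero (k - n)) (TreeVertex.zero (k - (n + 1 : ℕ))) := by
      right
      rw [TreeVertex.pred_zero]
      congr 1
      push_cast
      ring
    exact ⟨p.concat h, by simp [hp]⟩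

/-- The downward ray from the base vertex, which always follows predecessors. -/
def downRay : GeodRay tree :=
  ⟨fun n => TreeVertex.zero (-n), fun m n hmn => by
    have hw := tree_walk_down (-m) (n - m)
    have e : (-(m : ℤ) - ((n - m : ℕ) : ℤ)) = -n := by push_cast [hmn]; ring
    rw [e] at hw
    obtain ⟨p, hp⟩ := hw
    apply le_antisymm
    · have := SimpleGraph.edist_le p
      rwa [hp] at this
    · rw [SimpleGraph.edist_eq_sInf]
      apply le_sInf
      rintro _ ⟨q, rfl⟩
      have key : ∀ q : tree.Walk (TreeVertex.zero (-m)) (TreeVertex.zero (-n)),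
          n - m ≤ q.length := by
        intro q
        have h : (-(m : ℤ)) - (-(n : ℤ)) ≤ q.length := tree_walk_height q
        omega
      change ((n - m : ℕ) : ℕ∞) ≤ (q.length : ℕ∞)
      exact_mod_cast key q⟩

/-- The distinguished end of the tree. The ends of the tree are the points of its visual
boundary. -/
def omegaEnd : VisualBoundary tree := downRay.cls

/-- A path in the tree approaches the end `e` if from some time on it is a geodesic ray that
represents `e`. -/
def ApproachesEnd (x : ℕ → TreeVertex) (e : VisualBoundary tree) : Prop :=
  ∃ (N : ℕ) (ρ : GeodRay tree), ρ.cls = e ∧ ∀ n, x (N + n) = ρ n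

/-! ### The Diestel–Leader graph -/

/-- The vertices of the Diestel–Leader graph `DL₂(2)`: pairs of vertices of two copies `T₀`, `T₁`
of the tree, whose heights add up to zero. -/
@[ext] structure DLVertex where
  x₀ : TreeVertex
  x₁ : TreeVertex
  height_add : x₀.height + x₁.height = 0

/-- The Diestel–Leader graph `DL₂(2)`. -/
def DL : SimpleGraph DLVertex where
  Adj v w := tree.Adj v.x₀ w.x₀ ∧ tree.Adj v.x₁ w.x₁
  symm := ⟨fun _ _ h => ⟨h.1.symm, h.2.symm⟩⟩
  loopless := ⟨fun v h => tree.loopless.irrefl v.x₀ h.1⟩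

/-! ### The lamplighter group -/

/-- An element of the lamplighter group `L₂ = ℤ/2 ≀ ℤ`: a lamp stand, that is, the finitely many
lit lamps (those with value `1`) together with the position of the lamplighter. -/
@[ext] structure L2 where
  lamps : ℤ →₀ ZMod 2
  pos : ℤ

namespace L2

/-- Shift of the lamps by `k` to the right. -/
def shift (k : ℤ) (f : ℤ →₀ ZMod 2) : ℤ →₀ ZMod 2 := f.equivMapDomain (Equiv.addRight k)

@[simp] theorem shift_apply (k : ℤ) (f : ℤ →₀ ZMod 2) (i : ℤ) : shift k f i = f (i - k) := by
  simp [shift, sub_eq_add_neg]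

/-- Composition of lamp stands: `h` is performed from the position of the lamplighter in `g`. -/
instance : Mul L2 := ⟨fun g h => ⟨g.lamps + shift g.pos h.lamps, g.pos + h.pos⟩⟩
instance : One L2 := ⟨⟨0, 0⟩⟩
instance : Inv L2 := ⟨fun g => ⟨- shift (-g.pos) g.lamps, -g.pos⟩⟩

@[simp] theorem mul_lamps (g h : L2) : (g * h).lamps = g.lamps + shift g.pos h.lamps := rfl
@[simp] theorem mul_pos (g h : L2) : (g * h).pos = g.pos + h.pos := rfl
@[simp] theorem one_lamps : (1 : L2).lamps = 0 := rfl
@[simp] theorem one_pos : (1 : L2).pos = 0 := rfl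
@[simp] theorem inv_lamps (g : L2) : g⁻¹.lamps = - shift (-g.pos) g.lamps := rfl
@[simp] theorem inv_pos (g : L2) : g⁻¹.pos = -g.pos := rfl

instance : Group L2 :=
  Group.ofLeftAxioms
    (fun a b c => by
      ext i
      · simp [add_assoc, sub_sub]
      · simp [add_assoc])
    (fun a => by ext i <;> simp)
    (fun a => by ext i <;> simp)

/-- The generator of `ℤ`. -/
def t : L2 := ⟨0, 1⟩

/-- The generator of `ℤ/2`. -/
def a : L2 := ⟨Finsupp.single 0 1, 0⟩

/-- The exponent sum of `t`, as a homomorphism to `ℤ` with `a ↦ 0` and `t ↦ 1`. -/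
def expHom : L2 →* Multiplicative ℤ where
  toFun g := Multiplicative.ofAdd g.pos
  map_one' := rfl
  map_mul' _ _ := rfl

/-- The exponent sum of `t` in a group element. -/
def expT (g : L2) : ℤ := Multiplicative.toAdd (expHom g)

/-- Reflection of the row of lamps, exchanging `j` and `-1 - j`. -/
def reflect (f : ℤ →₀ ZMod 2) : ℤ →₀ ZMod 2 := f.equivMapDomain (Equiv.subLeft (-1))

@[simp] theorem reflect_apply (f : ℤ →₀ ZMod 2) (i : ℤ) : reflect f i = f (-1 - i) := by
  simp only [reflect, Finsupp.equivMapDomain_apply]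
  congr 1
  rw [Equiv.symm_apply_eq]
  simp

/-- The identification of lamp stands with vertices of `DL₂(2)`: the height in `T₀` is the
position `k` of the lamplighter, the labels in `T₀` are the states of the lamps at positions
`< k`, and the labels in `T₁` are those of the lamps at positions `≥ k`, read in the opposite
direction. -/
def vertexEquiv : L2 ≃ DLVertex where
  toFun g :=
    { x₀ := ⟨g.pos, g.lamps.filter (· < g.pos), fun i hi =>
        Finsupp.filter_apply_neg _ _ (not_lt.mpr hi)⟩
      x₁ := ⟨-g.pos, reflect (g.lamps.filter (g.pos ≤ ·)), fun i hi => by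
        rw [reflect_apply]
        exact Finsupp.filter_apply_neg _ _ (by omega)⟩
      height_add := by simp }
  invFun v := ⟨v.x₀.label + reflect v.x₁.label, v.x₀.height⟩
  left_inv g := by
    ext i
    · simp only [Finsupp.add_apply, reflect_apply, Finsupp.filter_apply]
      rw [show (-1 - (-1 - i)) = i by ring]
      by_cases h : i < g.pos
      · simp [h]
      · simp [h, not_lt.mp h]
    · rfl
  right_inv v := by
    have hv := v.height_add
    ext i
    · rfl
    · simp only [Finsupp.add_apply, reflect_apply, Finsupp.filter_apply]
      split_ifs with h
      · rw [v.x₁.label_eq_zero _ (by omega), add_zero]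
      · exact (v.x₀.label_eq_zero _ (by omega)).symm
    · change - v.x₀.height = v.x₁.height
      omega
    · simp only [Finsupp.add_apply, reflect_apply, Finsupp.filter_apply]
      rw [show (-1 - (-1 - i)) = i by ring]
      split_ifs with h
      · rw [v.x₀.label_eq_zero _ h, zero_add]
      · exact (v.x₁.label_eq_zero _ (by omega)).symm

theorem zmod2_cases (x : ZMod 2) : x = 0 ∨ x = 1 := by
  revert x
  decide

theorem up_iff (g h : L2) :
    ((vertexEquiv g).x₀ = (vertexEquiv h).x₀.pred ∧ (vertexEquiv h).x₁ = (vertexEquiv g).x₁.pred)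
      ↔ (h = g * t ∨ h = g * (a * t)) := by
  constructor
  · rintro ⟨h0, h1⟩
    have hp : h.pos = g.pos + 1 := by
      have := congrArg TreeVertex.height h0
      simp [vertexEquiv, TreeVertex.pred] at this
      omega
    have key : ∀ i, i ≠ g.pos → h.lamps i = g.lamps i := by
      intro i hi
      rcases lt_or_gt_of_ne hi with hlt | hgt
      · have := DFunLike.congr_fun (congrArg TreeVertex.label h0) i
        simp only [vertexEquiv, TreeVertex.pred, Equiv.coe_fn_mk, hp] at this
        rw [Finsupp.erase_ne (by omega), Finsupp.filter_apply, Finsupp.filter_apply,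
          if_pos hlt, if_pos (by omega)] at this
        exact this.symm
      · have := DFunLike.congr_fun (congrArg TreeVertex.label h1) (-1 - i)
        simp only [vertexEquiv, TreeVertex.pred, Equiv.coe_fn_mk, hp] at this
        rw [Finsupp.erase_ne (by omega), reflect_apply, reflect_apply,
          show (-1 - (-1 - i)) = i by ring, Finsupp.filter_apply, Finsupp.filter_apply,
          if_pos (by omega), if_pos (by omega)] at this
        exact this
    have hd : h.lamps g.pos = g.lamps g.pos ∨ h.lamps g.pos = g.lamps g.pos + 1 := by
      rcases zmod2_cases (h.lamps g.pos - g.lamps g.pos) with hc | hc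
      · left; exact sub_eq_zero.mp hc
      · right; rw [← hc]; ring
    rcases hd with hd | hd
    · left
      ext i
      · by_cases hi : i = g.pos
        · subst hi; simp [t, hd]
        · simp [t, key i hi]
      · simp [t, hp]
    · right
      ext i
      · by_cases hi : i = g.pos
        · subst hi; simp [t, a, hd]
        · have : (0 : ℤ) ≠ i - g.pos := by omega
          simp [t, a, key i hi, this]
      · simp [t, a, hp]
  · rintro (rfl | rfl)
    · constructor
      · ext i
        · simp [vertexEquiv, TreeVertex.pred, t]
        · by_cases hi : i = g.pos
          · subst hi; simp [vertexEquiv, TreeVertex.pred, t]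
          · have e : i ≤ g.pos ↔ i < g.pos := by omega
            simp [vertexEquiv, TreeVertex.pred, t, Finsupp.erase, Finsupp.filter_apply, hi, e]
      · ext i
        · simp [vertexEquiv, TreeVertex.pred, t]; ring
        · by_cases hi : i = -g.pos - 1
          · subst hi; simp [vertexEquiv, TreeVertex.pred, t, Finsupp.filter_apply]; omega
          · have e : g.pos < -1 - i ↔ g.pos ≤ -1 - i := by omega
            simp [vertexEquiv, TreeVertex.pred, t, Finsupp.erase, Finsupp.filter_apply, hi, e]
    · constructor
      · ext i
        · simp [vertexEquiv, TreeVertex.pred, t, a]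
        · by_cases hi : i = g.pos
          · subst hi; simp [vertexEquiv, TreeVertex.pred, t, a]
          · have e : i ≤ g.pos ↔ i < g.pos := by omega
            have e2 : (0 : ℤ) ≠ i - g.pos := by omega
            simp [vertexEquiv, TreeVertex.pred, t, a, Finsupp.erase, Finsupp.filter_apply, hi, e,
              e2]
      · ext i
        · simp [vertexEquiv, TreeVertex.pred, t, a]; ring
        · by_cases hi : i = -g.pos - 1
          · subst hi
            have e : ¬ g.pos < -1 - (-g.pos - 1) := by omega
            simp [vertexEquiv, TreeVertex.pred, t, a, e]
          · have e : g.pos < -1 - i ↔ g.pos ≤ -1 - i := by omega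
            have e2 : (0 : ℤ) ≠ -1 - i - g.pos := by omega
            simp [vertexEquiv, TreeVertex.pred, t, a, Finsupp.erase, Finsupp.filter_apply, hi, e,
              e2]

/-- `DL₂(2)` is the Cayley graph of `L₂` with respect to the generators `t` and `at`. -/
theorem adj_iff (g h : L2) :
    DL.Adj (vertexEquiv g) (vertexEquiv h) ↔
      (h = g * t ∨ h = g * (a * t)) ∨ (g = h * t ∨ g = h * (a * t)) := by
  rw [← up_iff, ← up_iff]
  have hg := (vertexEquiv g).height_add
  have hh := (vertexEquiv h).height_add
  constructor
  · rintro ⟨h0 | h0, h1 | h1⟩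
    · have e0 := congrArg TreeVertex.height h0
      have e1 := congrArg TreeVertex.height h1
      rw [TreeVertex.height_pred] at e0 e1
      omega
    · exact Or.inl ⟨h0, h1⟩
    · exact Or.inr ⟨h0, h1⟩
    · have e0 := congrArg TreeVertex.height h0
      have e1 := congrArg TreeVertex.height h1
      rw [TreeVertex.height_pred] at e0 e1
      omega
  · rintro (⟨h0, h1⟩ | ⟨h0, h1⟩)
    · exact ⟨Or.inl h0, Or.inr h1⟩
    · exact ⟨Or.inr h0, Or.inl h1⟩

/-- Left multiplication by `g`, as an automorphism of `DL₂(2)`. -/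
def toIso (g : L2) : DL ≃g DL where
  toEquiv := (vertexEquiv.symm.trans (Equiv.mulLeft g)).trans vertexEquiv
  map_rel_iff' := by
    intro v w
    obtain ⟨x, rfl⟩ := vertexEquiv.surjective v
    obtain ⟨y, rfl⟩ := vertexEquiv.surjective w
    simp [adj_iff, mul_assoc]

end L2

/-! ### The boundary of `DL₂(2)` and the action of `L₂` -/

/-- The asymptotic classes of geodesic rays in `DL₂(2)`. -/
abbrev Bdry : Type := VisualBoundary DL

/-- The action of `L₂` on the boundary induced by its action on the Cayley graph. -/
instance : MulAction L2 Bdry where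
  smul g := VisualBoundary.map g.toIso
  one_smul ξ := by
    obtain ⟨γ, rfl⟩ := Quotient.exists_rep ξ
    change GeodRay.cls (GeodRay.map _ γ) = GeodRay.cls γ
    congr 1
    apply Subtype.ext
    funext n
    simp [GeodRay.map, L2.toIso]
  mul_smul g h ξ := by
    obtain ⟨γ, rfl⟩ := Quotient.exists_rep ξ
    change GeodRay.cls (GeodRay.map _ γ) = GeodRay.cls (GeodRay.map _ (GeodRay.map _ γ))
    congr 1
    apply Subtype.ext
    funext n
    simp [GeodRay.map, L2.toIso]

/-- `(∂T₀ − ω₀) × {ω₁}`: the classes of the rays whose projection to `T₀` approaches an end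
other than `ω₀` and whose projection to `T₁` approaches `ω₁`. -/
def bdryPlus : Set Bdry :=
  {ξ | ∃ γ : GeodRay DL, γ.cls = ξ ∧
    (∃ e, e ≠ omegaEnd ∧ ApproachesEnd (fun n => (γ n).x₀) e) ∧
      ApproachesEnd (fun n => (γ n).x₁) omegaEnd}

/-- `(∂T₁ − ω₁) × {ω₀}`: the classes of the rays whose projection to `T₁` approaches an end
other than `ω₁` and whose projection to `T₀` approaches `ω₀`. -/
def bdryMinus : Set Bdry :=
  {ξ | ∃ γ : GeodRay DL, γ.cls = ξ ∧
    (∃ e, e ≠ omegaEnd ∧ ApproachesEnd (fun n => (γ n).x₁) e) ∧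
      ApproachesEnd (fun n => (γ n).x₀) omegaEnd}

/-- The class `ξ` has the lamp stand `f` (a state for every lamp), with the lamplighter at `+∞`
if `l = atTop` and at `-∞` if `l = atBot`. -/
def HasLampStand (ξ : Bdry) (f : ℤ → ZMod 2) (l : Filter ℤ) : Prop :=
  ∃ γ : GeodRay DL, γ.cls = ξ ∧
    (∀ i, ∀ᶠ n in atTop, (L2.vertexEquiv.symm (γ n)).lamps i = f i) ∧
      Tendsto (fun n => (L2.vertexEquiv.symm (γ n)).pos) atTop l

/-- `ξ` is `g^∞`: its lamp stand is the limit of the lamp stands of the powers `g ^ n`. -/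
def IsPowerLimit (g : L2) (ξ : Bdry) : Prop :=
  ∃ f : ℤ → ZMod 2, (∀ i, ∀ᶠ n : ℕ in atTop, (g ^ n).lamps i = f i) ∧
    ((0 < g.expT ∧ HasLampStand ξ f atTop) ∨ (g.expT < 0 ∧ HasLampStand ξ f atBot))

/-- North-south dynamics of `g` on the boundary with the topology `τ`, with attractor `α` and
repeller `ρ`. -/
def NorthSouth (τ : TopologicalSpace Bdry) (g : L2) (α ρ : Bdry) : Prop :=
  α ≠ ρ ∧ g • α = α ∧ g • ρ = ρ ∧
    (∀ ξ, ξ ≠ ρ → Tendsto (fun n : ℕ => g ^ n • ξ) atTop (@nhds Bdry τ α)) ∧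
    (∀ ξ, ξ ≠ α → Tendsto (fun n : ℕ => g⁻¹ ^ n • ξ) atTop (@nhds Bdry τ ρ)) ∧
    ∀ U V : Set Bdry, IsOpen[τ] U → IsOpen[τ] V → α ∈ U → ρ ∈ V →
      ∃ N : ℕ, ∀ n : ℕ, N ≤ n → (∀ ξ, ξ ∉ V → g ^ n • ξ ∈ U) ∧ (∀ ξ, ξ ∉ U → g⁻¹ ^ n • ξ ∈ V)

/-- Attraction in the two halves: the forward orbits of the points of `A` converge to `α ∈ A`,
and the backward orbits of the points of `R` converge to `ρ ∈ R`, in the topology based at any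
vertex. -/
def HalfAttraction (g : L2) (α ρ : Bdry) (A R : Set Bdry) : Prop :=
  α ∈ A ∧ ρ ∈ R ∧ ∀ p : DLVertex,
    (∀ ξ ∈ A, Tendsto (fun n : ℕ => g ^ n • ξ) atTop (@nhds Bdry (VisualBoundary.based DL p) α)) ∧
    (∀ ξ ∈ R, Tendsto (fun n : ℕ => g⁻¹ ^ n • ξ) atTop (@nhds Bdry (VisualBoundary.based DL p) ρ))

/-- `ξ` is represented by a ray from `p` without turns, along which the heights in the two trees
are monotone. -/
def HasTurnlessRay (p : DLVertex) (ξ : Bdry) : Prop :=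
  ∃ γ : GeodRay DL, γ.cls = ξ ∧ γ 0 = p ∧
    ((∀ n, (γ (n + 1)).x₀.height = (γ n).x₀.height + 1) ∨
      (∀ n, (γ (n + 1)).x₀.height = (γ n).x₀.height - 1))

end

noncomputable section

namespace L2

/-- `h` is obtained from `g` by moving one step to the right, with an arbitrary new state of the
lamp that is passed. -/
def UpStep (g h : L2) : Prop := h.pos = g.pos + 1 ∧ ∀ i, i ≠ g.pos → h.lamps i = g.lamps i

theorem upStep_iff (g h : L2) : UpStep g h ↔ h = g * t ∨ h = g * (a * t) := by
  constructor
  · rintro ⟨hp, key⟩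
    have hd : h.lamps g.pos = g.lamps g.pos ∨ h.lamps g.pos = g.lamps g.pos + 1 := by
      rcases zmod2_cases (h.lamps g.pos - g.lamps g.pos) with hc | hc
      · left; exact sub_eq_zero.mp hc
      · right; rw [← hc]; ring
    rcases hd with hd | hd
    · left
      ext i
      · by_cases hi : i = g.pos
        · subst hi; simp [t, hd]
        · simp [t, key i hi]
      · simp [t, hp]
    · right
      ext i
      · by_cases hi : i = g.pos
        · subst hi; simp [t, a, hd]
        · have : (0 : ℤ) ≠ i - g.pos := by omega
          simp [t, a, key i hi, this]
      · simp [t, a, hp]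
  · rintro (rfl | rfl)
    · exact ⟨by simp [t], fun i _ => by simp [t]⟩
    · refine ⟨by simp [t, a], fun i hi => ?_⟩
      have : (0 : ℤ) ≠ i - g.pos := by omega
      simp [t, a, this]

/-- The automorphism of the lamplighter group that reflects the row of lamps. -/
def mirror : L2 ≃* L2 where
  toFun g := ⟨reflect g.lamps, -g.pos⟩
  invFun g := ⟨reflect g.lamps, -g.pos⟩
  left_inv g := by ext i <;> simp
  right_inv g := by ext i <;> simp
  map_mul' g h := by
    ext i
    · simp only [reflect_apply, mul_lamps, Finsupp.add_apply, shift_apply]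
      congr 2
      ring
    · simp only [mul_pos]; ring

@[simp] theorem mirror_pos (g : L2) : (mirror g).pos = -g.pos := rfl

@[simp] theorem mirror_lamps (g : L2) (i : ℤ) : (mirror g).lamps i = g.lamps (-1 - i) := by
  simp [mirror]

theorem mirror_mirror (g : L2) : mirror (mirror g) = g := by ext i <;> simp

theorem upStep_mirror (g h : L2) : UpStep (mirror g) (mirror h) ↔ UpStep h g := by
  simp only [UpStep, mirror_pos, mirror_lamps]
  constructor
  · rintro ⟨hp, hl⟩
    refine ⟨by omega, fun i hi => ?_⟩
    have := hl (-1 - i) (by omega)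
    rw [show -1 - (-1 - i) = i by ring] at this
    exact this.symm
  · rintro ⟨hp, hl⟩
    exact ⟨by omega, fun i hi => (hl _ (by omega)).symm⟩

end L2

open L2

/-- A lamp stand coordinate on the vertices of the Diestel–Leader graph for which adjacency is
motion of the lamplighter by one step. -/
@[ext] structure Chart where
  coord : DLVertex ≃ L2
  adj_iff : ∀ v w, DL.Adj v w ↔ UpStep (coord v) (coord w) ∨ UpStep (coord w) (coord v)

namespace Chart

/-- The chart given by the identification of vertices with lamp stands. -/
def std : Chart where
  coord := vertexEquiv.symm
  adj_iff v w := by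
    obtain ⟨g, rfl⟩ := vertexEquiv.surjective v
    obtain ⟨h, rfl⟩ := vertexEquiv.surjective w
    simp [L2.adj_iff, upStep_iff]

/-- The chart in which the row of lamps is read in the opposite direction. -/
def opp (c : Chart) : Chart where
  coord := c.coord.trans mirror.toEquiv
  adj_iff v w := by
    simp only [Equiv.trans_apply, MulEquiv.toEquiv_eq_coe, MulEquiv.coe_toEquiv, upStep_mirror,
      c.adj_iff]
    exact or_comm

variable (c : Chart)

theorem opp_opp : c.opp.opp = c := by
  ext1
  ext1 v
  exact mirror_mirror _

/-- The position of the lamplighter. -/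
def pos (v : DLVertex) : ℤ := (c.coord v).pos

/-- The states of the lamps. -/
def lamp (v : DLVertex) : ℤ →₀ ZMod 2 := (c.coord v).lamps

@[simp] theorem opp_pos (v : DLVertex) : c.opp.pos v = -c.pos v := rfl

@[simp] theorem opp_lamp (v : DLVertex) (i : ℤ) : c.opp.lamp v i = c.lamp v (-1 - i) :=
  mirror_lamps _ _

theorem ext_vertex {v w : DLVertex} (hp : c.pos v = c.pos w) (hl : ∀ i, c.lamp v i = c.lamp w i) :
    v = w :=
  c.coord.injective (L2.ext (Finsupp.ext hl) hp)

/-- The vertex with a given lamp stand. -/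
def vertex (f : ℤ →₀ ZMod 2) (k : ℤ) : DLVertex := c.coord.symm ⟨f, k⟩

@[simp] theorem pos_vertex (f : ℤ →₀ ZMod 2) (k : ℤ) : c.pos (c.vertex f k) = k := by
  simp [pos, vertex]

@[simp] theorem lamp_vertex (f : ℤ →₀ ZMod 2) (k : ℤ) : c.lamp (c.vertex f k) = f := by
  simp [lamp, vertex]

variable {c} {v w : DLVertex}

theorem adj_of_up (hp : c.pos w = c.pos v + 1)
    (hl : ∀ i, i ≠ c.pos v → c.lamp w i = c.lamp v i) : DL.Adj v w :=
  (c.adj_iff v w).2 (Or.inl ⟨hp, hl⟩)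

theorem pos_of_adj (h : DL.Adj v w) : c.pos w = c.pos v + 1 ∨ c.pos w = c.pos v - 1 := by
  rcases (c.adj_iff v w).1 h with h | h
  · exact Or.inl h.1
  · right
    have := h.1
    simp only [pos]
    omega

theorem lamp_of_adj (h : DL.Adj v w) {i : ℤ} (hi : i ≠ min (c.pos v) (c.pos w)) :
    c.lamp w i = c.lamp v i := by
  simp only [pos] at hi
  rcases (c.adj_iff v w).1 h with h | h
  · have := h.1
    exact h.2 i (by omega)
  · have := h.1
    exact (h.2 i (by omega)).symm

/-! ### Lengths of walks -/

variable (c) in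
theorem pos_sub_le_length (q : DL.Walk v w) : c.pos v - c.pos w ≤ q.length := by
  induction q with
  | nil => simp
  | cons h q ih =>
    rw [SimpleGraph.Walk.length_cons]
    rcases pos_of_adj (c := c) h with h | h <;> push_cast <;> omega

variable (c) in
theorem sub_pos_le_length (q : DL.Walk v w) : c.pos w - c.pos v ≤ q.length := by
  simpa [add_comm, sub_eq_add_neg] using c.opp.pos_sub_le_length q

/-- A walk between vertices that differ in the lamp at `m` passes that lamp. -/
theorem add_pos_le_length {m : ℤ} (q : DL.Walk v w) (hm : c.lamp v m ≠ c.lamp w m) :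
    c.pos v + c.pos w - 2 * m ≤ q.length := by
  induction q with
  | nil => exact absurd rfl hm
  | @cons u v w h q ih =>
    rw [SimpleGraph.Walk.length_cons]
    have hp := pos_of_adj (c := c) h
    have h2 := c.sub_pos_le_length q
    by_cases hv : c.lamp v m = c.lamp w m
    · have : m = min (c.pos u) (c.pos v) := by
        by_contra hne
        exact hm ((lamp_of_adj h hne).symm.trans hv)
      push_cast
      omega
    · have := ih hv
      push_cast
      omega

end Chart

theorem SimpleGraph.le_edist_of_forall_walk {V : Type*} {G : SimpleGraph V} {u v : V} {n : ℕ}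
    (h : ∀ q : G.Walk u v, n ≤ q.length) : (n : ℕ∞) ≤ G.edist u v := by
  by_cases ht : G.edist u v = ⊤
  · simp [ht]
  · obtain ⟨q, hq⟩ := SimpleGraph.exists_walk_of_edist_ne_top ht
    rw [← hq]
    exact_mod_cast h q

theorem SimpleGraph.exists_walk_of_edist_le {V : Type*} {G : SimpleGraph V} {u v : V} {n : ℕ}
    (h : G.edist u v ≤ n) : ∃ q : G.Walk u v, q.length ≤ n := by
  obtain ⟨q, hq⟩ := SimpleGraph.exists_walk_of_edist_ne_top
    (ne_top_of_le_ne_top (ENat.natCast_ne_top n) h)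
  rw [← hq] at h
  exact ⟨q, by exact_mod_cast h⟩

namespace Chart

variable {c : Chart} {v w : DLVertex}

/-- The lamps in the half-open interval from `lo` to `hi` of `f` are replaced by those of `g`. -/
def patch (f : ℤ →₀ ZMod 2) (lo hi : ℤ) (g : ℤ → ZMod 2) : ℤ →₀ ZMod 2 :=
  f + Finsupp.onFinset (Finset.Ico lo hi) (fun i => if lo ≤ i ∧ i < hi then g i - f i else 0)
    (fun i hi => by
      rw [Finset.mem_Ico]
      by_contra h
      simp [h] at hi)

theorem patch_apply (f : ℤ →₀ ZMod 2) (lo hi : ℤ) (g : ℤ → ZMod 2) (i : ℤ) :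
    patch f lo hi g i = if lo ≤ i ∧ i < hi then g i else f i := by
  simp only [patch, Finsupp.add_apply, Finsupp.onFinset_apply]
  split_ifs <;> simp

/-- Moving to the right, the lamplighter can change all lamps that are passed. -/
theorem edist_le_of_sweep {n : ℕ} (hp : c.pos w = c.pos v + n)
    (hl : ∀ i, (i < c.pos v ∨ c.pos w ≤ i) → c.lamp v i = c.lamp w i) : DL.edist v w ≤ n := by
  induction n generalizing v with
  | zero =>
    have : v = w := c.ext_vertex (by simpa using hp.symm) (fun i => hl i (by
      push_cast at hp
      omega))
    simp [this]
  | succ n ih =>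
    push_cast at hp
    let u := c.vertex (patch (c.lamp v) (c.pos v) (c.pos v + 1) (c.lamp w)) (c.pos v + 1)
    have h1 : DL.Adj v u := by
      refine adj_of_up (c := c) (by simp [u]) (fun i hi => ?_)
      simp only [u, lamp_vertex, patch_apply]
      rw [if_neg (by omega)]
    have h2 : DL.edist u w ≤ n := by
      refine ih (by simp [u]; omega) (fun i hi => ?_)
      simp only [u, lamp_vertex, patch_apply]
      simp only [u, pos_vertex] at hi
      split_ifs with h
      · rfl
      · exact hl i (by omega)
    calc DL.edist v w ≤ DL.edist v u + DL.edist u w := SimpleGraph.edist_triangle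
      _ ≤ 1 + n := add_le_add (SimpleGraph.edist_eq_one_iff_adj.2 h1).le h2
      _ = ((n + 1 : ℕ) : ℕ∞) := by push_cast; rw [add_comm]

theorem edist_le_of_window {lo hi : ℤ} {n : ℕ} (hvw : c.pos v ≤ c.pos w) (hlo : lo ≤ c.pos v)
    (hhi : c.pos w ≤ hi) (hl : ∀ i, (i < lo ∨ hi ≤ i) → c.lamp v i = c.lamp w i)
    (hn : n = 2 * (hi - lo) - (c.pos w - c.pos v)) : DL.edist v w ≤ n := by
  let a := c.vertex (c.lamp v) lo
  let b := c.vertex (c.lamp w) hi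
  have h1 : DL.edist v a ≤ ((c.pos v - lo).toNat : ℕ) := by
    rw [SimpleGraph.edist_comm]
    refine edist_le_of_sweep (c := c) (by simp [a]; omega) (fun i _ => by simp [a])
  have h2 : DL.edist a b ≤ ((hi - lo).toNat : ℕ) :=
    edist_le_of_sweep (c := c) (by simp [a, b]; omega) (fun i h => by
      simp only [a, b, pos_vertex, lamp_vertex] at h ⊢; exact hl i h)
  have h3 : DL.edist b w ≤ ((hi - c.pos w).toNat : ℕ) := by
    rw [SimpleGraph.edist_comm]
    refine edist_le_of_sweep (c := c) (by simp [b]; omega) (fun i _ => by simp [b])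
  calc DL.edist v w ≤ DL.edist v a + DL.edist a w := SimpleGraph.edist_triangle
    _ ≤ DL.edist v a + (DL.edist a b + DL.edist b w) := by
        gcongr; exact SimpleGraph.edist_triangle
    _ ≤ ((c.pos v - lo).toNat : ℕ) + (((hi - lo).toNat : ℕ) + ((hi - c.pos w).toNat : ℕ)) :=
        add_le_add h1 (add_le_add h2 h3)
    _ = n := by norm_cast; omega

theorem edist_le_of_window_abs {lo hi : ℤ} {n : ℕ} (hv : lo ≤ c.pos v) (hv' : c.pos v ≤ hi)
    (hw : lo ≤ c.pos w) (hw' : c.pos w ≤ hi)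
    (hl : ∀ i, (i < lo ∨ hi ≤ i) → c.lamp v i = c.lamp w i)
    (hn : n = 2 * (hi - lo) - |c.pos w - c.pos v|) : DL.edist v w ≤ n := by
  rcases le_total (c.pos v) (c.pos w) with h | h
  · rw [abs_of_nonneg (by omega)] at hn
    exact edist_le_of_window h hv hw' hl hn
  · rw [abs_of_nonpos (by omega)] at hn
    rw [SimpleGraph.edist_comm]
    exact edist_le_of_window h hw hv' (fun i hi => (hl i hi).symm) (by omega)

end Chart

/-! ### Paths whose length is bounded in terms of their range -/

section Profile

variable {k : ℕ → ℤ}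

theorem sub_le_of_steps (hs : ∀ n, k (n + 1) = k n + 1 ∨ k (n + 1) = k n - 1) (m n : ℕ) :
    k (m + n) - k m ≤ n ∧ k m - k (m + n) ≤ n := by
  induction n with
  | zero => simp
  | succ n ih =>
    rw [← add_assoc]
    push_cast
    rcases hs (m + n) with h | h <;> omega

/-- After a peak the path goes down forever. -/
theorem down_of_peak (hs : ∀ n, k (n + 1) = k n + 1 ∨ k (n + 1) = k n - 1)
    (hb : ∀ (i j : ℕ) (lo hi : ℤ), i ≤ j → (∀ m, i ≤ m → m ≤ j → lo ≤ k m ∧ k m ≤ hi) →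
      (j : ℤ) - i ≤ 2 * (hi - lo) - |k j - k i|)
    {i : ℕ} (h0 : k (i + 1) = k i + 1) (h1 : k (i + 2) = k (i + 1) - 1) (n : ℕ) :
    k (i + 1 + n) = k (i + 1) - n := by
  by_contra hcon
  have hex : ∃ n, k (i + 1 + n) ≠ k (i + 1) - (n : ℕ) := ⟨n, hcon⟩
  classical
  obtain ⟨l, hl⟩ : ∃ l : ℕ, Nat.find hex = l + 2 := by
    have hz : Nat.find hex ≠ 0 := fun h => by
      have := Nat.find_spec hex
      rw [h] at this
      simp at this
    have ho : Nat.find hex ≠ 1 := fun h => by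
      have := Nat.find_spec hex
      rw [h] at this
      simp only [Nat.cast_one] at this
      exact this h1
    exact ⟨Nat.find hex - 2, by omega⟩
  have hspec := Nat.find_spec hex
  rw [hl] at hspec
  have hmin : ∀ m ≤ l + 1, k (i + 1 + m) = k (i + 1) - m := fun m hm => by
    have := Nat.find_min hex (m := m) (by omega)
    rwa [not_not] at this
  have hlow := hmin (l + 1) le_rfl
  have hup : k (i + l + 3) = k i - l + 1 := by
    rcases hs (i + 1 + (l + 1)) with h | h
    · rw [show i + l + 3 = i + 1 + (l + 1) + 1 by ring, h, hlow]
      push_cast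
      omega
    · exfalso
      apply hspec
      rw [show i + 1 + (l + 2) = i + 1 + (l + 1) + 1 by ring, h, hlow]
      push_cast
      omega
  have hfirst : ∀ m, i ≤ m → m ≤ i + l + 2 → k i - l ≤ k m ∧ k m ≤ k i + 1 := by
    intro m hm hm'
    rcases eq_or_lt_of_le hm with rfl | hlt
    · constructor <;> omega
    · have := hmin (m - i - 1) (by omega)
      rw [show i + 1 + (m - i - 1) = m by omega] at this
      constructor <;> omega
  have hstay : ∀ n : ℕ, ∀ m, i + l + 2 ≤ m → m ≤ i + l + 2 + n → k i - l ≤ k m ∧ k m ≤ k i := by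
    intro n
    induction n with
    | zero =>
      intro m hm hm'
      obtain rfl : m = i + 1 + (l + 1) := by omega
      rw [hlow]
      push_cast
      constructor <;> omega
    | succ n ih =>
      intro m hm hm'
      rcases Nat.lt_or_ge m (i + l + 2 + (n + 1)) with hlt | hge
      · exact ih m hm (by omega)
      obtain rfl : m = i + l + 2 + n + 1 := by omega
      have hn := ih (i + l + 2 + n) (by omega) le_rfl
      have hL := sub_le_of_steps hs (i + l + 3) n
      rw [show i + l + 3 + n = i + l + 2 + n + 1 by ring] at hL
      have hrange : ∀ lo hi : ℤ, lo ≤ k i - l → k i + 1 ≤ hi → lo ≤ k (i + l + 2 + n + 1) →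
          k (i + l + 2 + n + 1) ≤ hi →
          ∀ m', i ≤ m' → m' ≤ i + l + 2 + n + 1 → lo ≤ k m' ∧ k m' ≤ hi := by
        intro lo hi h1 h2 h3 h4 m' hm1 hm2
        rcases eq_or_lt_of_le hm2 with rfl | hlt
        · exact ⟨h3, h4⟩
        rcases Nat.le_total m' (i + l + 2) with h | h
        · have := hfirst m' hm1 h
          constructor <;> omega
        · have := ih m' h (by omega)
          constructor <;> omega
      by_contra hout
      rcases hs (i + l + 2 + n) with h | h
      · have := hb i (i + l + 2 + n + 1) (k i - l) (k i + 1) (by omega)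
          (hrange _ _ (by omega) (by omega) (by omega) (by omega))
        rw [abs_of_nonneg (by omega)] at this
        push_cast at this
        omega
      · have := hb i (i + l + 2 + n + 1) (k i - l - 1) (k i + 1) (by omega)
          (hrange _ _ (by omega) (by omega) (by omega) (by omega))
        rw [abs_of_nonpos (by omega)] at this
        push_cast at this
        omega
  have := hb i (i + l + 2 + (l + 1)) (k i - l) (k i + 1) (by omega) (fun m hm hm' => by
    rcases Nat.le_total m (i + l + 2) with h | h
    · exact hfirst m hm h
    · have := hstay (l + 1) m h hm'
      constructor <;> omega)
  have hnn := abs_nonneg (k (i + l + 2 + (l + 1)) - k i)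
  push_cast at this
  omega

theorem profile_of_up (hs : ∀ n, k (n + 1) = k n + 1 ∨ k (n + 1) = k n - 1)
    (hb : ∀ (i j : ℕ) (lo hi : ℤ), i ≤ j → (∀ m, i ≤ m → m ≤ j → lo ≤ k m ∧ k m ≤ hi) →
      (j : ℤ) - i ≤ 2 * (hi - lo) - |k j - k i|) (h0 : k 1 = k 0 + 1) :
    (∀ n : ℕ, k n = k 0 + n) ∨ ∃ d : ℕ, ∀ n : ℕ, k n = k 0 - n + 2 * min n d := by
  by_cases hex : ∃ n : ℕ, k n ≠ k 0 + n
  · right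
    classical
    obtain ⟨l, hl⟩ : ∃ l : ℕ, Nat.find hex = l + 2 := by
      have hz : Nat.find hex ≠ 0 := fun h => by
        have := Nat.find_spec hex
        rw [h] at this
        simp at this
      have ho : Nat.find hex ≠ 1 := fun h => by
        have := Nat.find_spec hex
        rw [h] at this
        simp only [Nat.cast_one] at this
        exact this h0
      exact ⟨Nat.find hex - 2, by omega⟩
    have hspec := Nat.find_spec hex
    rw [hl] at hspec
    have hmin : ∀ m ≤ l + 1, k m = k 0 + m := fun m hm => by
      have := Nat.find_min hex (m := m) (by omega)
      rwa [not_not] at this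
    have e0 := hmin l (by omega)
    have e1 := hmin (l + 1) le_rfl
    push_cast at e1 hspec
    have hd := down_of_peak hs hb (i := l) (by omega) (by
      rcases hs (l + 1) with h | h
      · exact absurd (by rw [h]; omega) hspec
      · exact h)
    refine ⟨l + 1, fun n => ?_⟩
    push_cast
    rcases Nat.le_total n (l + 1) with h | h
    · rw [hmin n h]
      omega
    · have := hd (n - (l + 1))
      rw [show l + 1 + (n - (l + 1)) = n by omega] at this
      rw [this]
      omega
  · left
    push Not at hex
    exact hex

theorem profile (hs : ∀ n, k (n + 1) = k n + 1 ∨ k (n + 1) = k n - 1)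
    (hb : ∀ (i j : ℕ) (lo hi : ℤ), i ≤ j → (∀ m, i ≤ m → m ≤ j → lo ≤ k m ∧ k m ≤ hi) →
      (j : ℤ) - i ≤ 2 * (hi - lo) - |k j - k i|) :
    (∃ d : ℕ, ∀ n : ℕ, k n = k 0 + n - 2 * min n d) ∨
      ∃ d : ℕ, ∀ n : ℕ, k n = k 0 - n + 2 * min n d := by
  rcases hs 0 with h0 | h0
  · rcases profile_of_up hs hb h0 with h | h
    · exact Or.inl ⟨0, fun n => by rw [h n]; push_cast; omega⟩
    · exact Or.inr h
  · have := profile_of_up (k := fun n => -k n) (fun n => by rcases hs n with h | h <;> omega)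
      (fun i j lo hi hij hm => by
        have := hb i j (-hi) (-lo) hij (fun m h1 h2 => by
          have := hm m h1 h2
          constructor <;> omega)
        rw [show -k j - -k i = -(k j - k i) by ring, abs_neg]
        omega) (by simp only [zero_add] at h0; omega)
    rcases this with h | ⟨d, h⟩
    · exact Or.inr ⟨0, fun n => by have := h n; push_cast; omega⟩
    · exact Or.inl ⟨d, fun n => by have := h n; omega⟩

end Profile

/-! ### Geodesic rays -/

theorem GeodRay.adj {V : Type*} {G : SimpleGraph V} (γ : GeodRay G) (n : ℕ) :
    G.Adj (γ n) (γ (n + 1)) := by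
  rw [← SimpleGraph.edist_eq_one_iff_adj, γ.2 n (n + 1) (by omega)]
  simp

theorem GeodRay.cls_eq_iff {V : Type*} {G : SimpleGraph V} {γ γ' : GeodRay G} :
    γ.cls = γ'.cls ↔ ∃ C : ℕ, ∀ n : ℕ, G.edist (γ n) (γ' n) ≤ (C : ℕ∞) :=
  Quotient.eq (r := GeodRay.asymptotic G)

theorem GeodRay.cls_eq_of_le {V : Type*} {G : SimpleGraph V} {γ γ' : GeodRay G} {N C : ℕ}
    (h : ∀ n, N ≤ n → G.edist (γ n) (γ' n) ≤ C) : γ.cls = γ'.cls := by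
  rw [GeodRay.cls_eq_iff]
  refine ⟨N + (C + N), fun n => ?_⟩
  rcases Nat.le_total N n with hn | hn
  · exact (h n hn).trans (by norm_cast; omega)
  · calc G.edist (γ n) (γ' n) ≤ G.edist (γ n) (γ N) + G.edist (γ N) (γ' n) :=
          SimpleGraph.edist_triangle
      _ ≤ G.edist (γ n) (γ N) + (G.edist (γ N) (γ' N) + G.edist (γ' N) (γ' n)) := by
          gcongr; exact SimpleGraph.edist_triangle
      _ ≤ (N : ℕ) + ((C : ℕ) + (N : ℕ)) := by
          refine add_le_add ?_ (add_le_add (h N le_rfl) ?_)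
          · rw [γ.2 n N hn]
            norm_cast
            omega
          · rw [SimpleGraph.edist_comm, γ'.2 n N hn]
            norm_cast
            omega
      _ = _ := by norm_cast

namespace Chart

variable {c : Chart} {x : ℕ → DLVertex}

theorem lamp_eq_of_above (hx : ∀ n, DL.Adj (x n) (x (n + 1))) {m n : ℕ} (hmn : m ≤ n) {i : ℤ}
    (hi : ∀ j, m ≤ j → j ≤ n → i < c.pos (x j)) : c.lamp (x n) i = c.lamp (x m) i := by
  induction n, hmn using Nat.le_induction with
  | base => rfl
  | succ n hmn ih =>
    rw [← ih (fun j h1 h2 => hi j h1 (by omega))]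
    have h1 := hi n hmn (by omega)
    have h2 := hi (n + 1) (by omega) le_rfl
    exact lamp_of_adj (hx n) (by omega)

theorem lamp_eq_of_below (hx : ∀ n, DL.Adj (x n) (x (n + 1))) {m n : ℕ} (hmn : m ≤ n) {i : ℤ}
    (hi : ∀ j, m ≤ j → j ≤ n → c.pos (x j) ≤ i) : c.lamp (x n) i = c.lamp (x m) i := by
  have := lamp_eq_of_above (c := c.opp) hx hmn (i := -1 - i) (fun j h1 h2 => by
    have := hi j h1 h2
    rw [opp_pos]
    omega)
  simpa using this

theorem length_le_of_range (c : Chart) (γ : GeodRay DL) (i j : ℕ) (lo hi : ℤ) (hij : i ≤ j)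
    (hm : ∀ m, i ≤ m → m ≤ j → lo ≤ c.pos (γ m) ∧ c.pos (γ m) ≤ hi) :
    (j : ℤ) - i ≤ 2 * (hi - lo) - |c.pos (γ j) - c.pos (γ i)| := by
  have h1 := hm i le_rfl hij
  have h2 := hm j hij le_rfl
  have habs : |c.pos (γ j) - c.pos (γ i)| ≤ hi - lo := abs_le.2 ⟨by omega, by omega⟩
  have := edist_le_of_window_abs (c := c) (v := γ i) (w := γ j) (lo := lo) (hi := hi)
    (n := (2 * (hi - lo) - |c.pos (γ j) - c.pos (γ i)|).toNat) h1.1 h1.2 h2.1 h2.2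
    (fun l hl => by
      rcases hl with hl | hl
      · exact (lamp_eq_of_above γ.adj hij (fun m a b => by have := hm m a b; omega)).symm
      · exact (lamp_eq_of_below γ.adj hij (fun m a b => by have := hm m a b; omega)).symm)
    (by omega)
  rw [γ.2 i j hij] at this
  norm_cast at this
  omega

/-- The ray goes down `d` steps and then up forever, with limit `f` of the lamps. -/
structure RayTo (c : Chart) (γ : GeodRay DL) (d : ℕ) (f : ℤ → ZMod 2) : Prop where
  pos (n : ℕ) : c.pos (γ n) = c.pos (γ 0) + n - 2 * min n d
  lamp (n : ℕ) (hn : d ≤ n) (i : ℤ) (hi : i < c.pos (γ n)) : c.lamp (γ n) i = f i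

theorem exists_rayTo_of_pos {γ : GeodRay DL} {d : ℕ}
    (hp : ∀ n : ℕ, c.pos (γ n) = c.pos (γ 0) + n - 2 * min n d) : ∃ f, c.RayTo γ d f := by
  have key : ∀ m n : ℕ, d ≤ m → m ≤ n → ∀ i < c.pos (γ m), c.lamp (γ n) i = c.lamp (γ m) i := by
    intro m n hm hmn i hi
    refine lamp_eq_of_above γ.adj hmn (fun j h1 h2 => ?_)
    have := hp m
    have := hp j
    omega
  refine ⟨fun i => c.lamp (γ (2 * d + (i - c.pos (γ 0) + 1).toNat)) i, hp, fun n hn i hi => ?_⟩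
  have := hp n
  have h2 := hp (2 * d + (i - c.pos (γ 0) + 1).toNat)
  push_cast at h2
  rcases Nat.le_total n (2 * d + (i - c.pos (γ 0) + 1).toNat) with h | h
  · exact (key _ _ hn h i hi).symm
  · exact key _ _ (by omega) h i (by omega)

theorem exists_rayTo (c : Chart) (γ : GeodRay DL) :
    (∃ d f, c.RayTo γ d f) ∨ ∃ d f, c.opp.RayTo γ d f := by
  rcases profile (k := fun n => c.pos (γ n)) (fun n => pos_of_adj (γ.adj n))
    (c.length_le_of_range γ) with ⟨d, h⟩ | ⟨d, h⟩
  · exact Or.inl ⟨d, exists_rayTo_of_pos h⟩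
  · exact Or.inr ⟨d, exists_rayTo_of_pos fun n => by
      have := h n
      simp only [opp_pos]
      omega⟩

namespace RayTo

variable {γ γ' : GeodRay DL} {d d' : ℕ} {f f' : ℤ → ZMod 2}

theorem lamp_start (h : c.RayTo γ d f) {i : ℤ} (hi : i < c.pos (γ 0) - d) :
    f i = c.lamp (γ 0) i := by
  have hd := h.pos d
  rw [← h.lamp d le_rfl i (by omega)]
  refine lamp_eq_of_above γ.adj (Nat.zero_le d) (fun j _ _ => ?_)
  have := h.pos j
  omega

/-- The lamps that are not reached by the ray. -/
theorem lamp_above (h : c.RayTo γ d f) {n : ℕ} {i : ℤ} (h0 : c.pos (γ 0) ≤ i)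
    (hn : c.pos (γ n) ≤ i) : c.lamp (γ n) i = c.lamp (γ 0) i := by
  refine lamp_eq_of_below γ.adj (Nat.zero_le _) (fun j _ _ => ?_)
  have := h.pos j
  have := h.pos n
  omega

theorem cls_eq_of_le (h : c.RayTo γ d f) (h' : c.RayTo γ' d' f)
    (hle : c.pos (γ 0) - 2 * d ≤ c.pos (γ' 0) - 2 * d') : γ.cls = γ'.cls := by
  obtain ⟨B, hB⟩ : ∃ B : ℤ, ∀ i, B ≤ i → c.lamp (γ 0) i = 0 ∧ c.lamp (γ' 0) i = 0 := by
    obtain ⟨B, hB⟩ := (c.lamp (γ 0)).hasFiniteSupport.bddAbove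
    obtain ⟨B', hB'⟩ := (c.lamp (γ' 0)).hasFiniteSupport.bddAbove
    refine ⟨max B B' + 1, fun i hi => ⟨?_, ?_⟩⟩
    · by_contra hne
      have := hB (Function.mem_support.2 hne)
      omega
    · by_contra hne
      have := hB' (Function.mem_support.2 hne)
      omega
  refine GeodRay.cls_eq_of_le (N := 2 * d + 2 * d' + (B - c.pos (γ 0)).toNat)
    (C := (c.pos (γ' 0) - 2 * d' - (c.pos (γ 0) - 2 * d)).toNat) (fun n hn => ?_)
  have e := h.pos n
  have e' := h'.pos n
  refine edist_le_of_sweep (c := c) (by omega) (fun i hi => ?_)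
  rcases hi with hi | hi
  · rw [h.lamp n (by omega) i hi, h'.lamp n (by omega) i (by omega)]
  · rw [h.lamp_above (by omega) (by omega), h'.lamp_above (by omega) hi,
      (hB i (by omega)).1, (hB i (by omega)).2]

/-- Rays with the same limit of the lamps are asymptotic. -/
theorem cls_eq (h : c.RayTo γ d f) (h' : c.RayTo γ' d' f) : γ.cls = γ'.cls := by
  rcases le_total (c.pos (γ 0) - 2 * d) (c.pos (γ' 0) - 2 * d') with hle | hle
  · exact h.cls_eq_of_le h' hle
  · exact (h'.cls_eq_of_le h hle).symm

theorem not_opp (h : c.RayTo γ d f) (h' : c.opp.RayTo γ' d' f') : γ.cls ≠ γ'.cls := by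
  rw [Ne, GeodRay.cls_eq_iff]
  rintro ⟨C, hC⟩
  obtain ⟨q, hq⟩ := SimpleGraph.exists_walk_of_edist_le
    (hC (C + d + d' + (c.pos (γ' 0) - c.pos (γ 0)).toNat + 1))
  have h1 := c.pos_sub_le_length q
  have h2 := h.pos (C + d + d' + (c.pos (γ' 0) - c.pos (γ 0)).toNat + 1)
  have h3 := h'.pos (C + d + d' + (c.pos (γ' 0) - c.pos (γ 0)).toNat + 1)
  simp only [opp_pos] at h3
  push_cast at h2 h3
  omega

theorem limit_unique (h : c.RayTo γ d f) (h' : c.RayTo γ' d' f') (he : γ.cls = γ'.cls) :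
    f = f' := by
  rw [GeodRay.cls_eq_iff] at he
  obtain ⟨C, hC⟩ := he
  funext i
  obtain ⟨n, hn⟩ : ∃ n : ℕ, n = C + 2 * d + 2 * d' + (i - c.pos (γ 0)).toNat +
    (i - c.pos (γ' 0)).toNat + 1 := ⟨_, rfl⟩
  obtain ⟨q, hq⟩ := SimpleGraph.exists_walk_of_edist_le (hC n)
  have h1 := h.pos n
  have h2 := h'.pos n
  rw [← h.lamp n (by omega) i (by omega), ← h'.lamp n (by omega) i (by omega)]
  by_contra hne
  have := add_pos_le_length (c := c) q hne
  omega

theorem exists_of_cls_eq (h : c.RayTo γ d f) (he : γ.cls = γ'.cls) : ∃ d', c.RayTo γ' d' f := by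
  rcases c.exists_rayTo γ' with ⟨d', f', h'⟩ | ⟨d', f', h'⟩
  · obtain rfl := h.limit_unique h' he
    exact ⟨d', h'⟩
  · exact absurd he (h.not_opp h')

end RayTo

/-! ### Rays with one turn -/

/-- The path that goes down `d` steps from `p`, leaving behind the lamps of `e`, and then goes up
forever, leaving behind the lamps of `f`. -/
def bentPath (c : Chart) (p : DLVertex) (d : ℕ) (e f : ℤ → ZMod 2) (n : ℕ) : DLVertex :=
  c.vertex (patch (patch (c.lamp p) (c.pos p - min n d) (c.pos p) e) (c.pos p - d)
    (c.pos p - 2 * d + n) f) (c.pos p + n - 2 * min n d)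

variable {p : DLVertex} {d : ℕ} {e f : ℤ → ZMod 2}

theorem pos_bentPath (n : ℕ) : c.pos (c.bentPath p d e f n) = c.pos p + n - 2 * min n d := by
  simp [bentPath]

theorem lamp_bentPath (n : ℕ) (i : ℤ) : c.lamp (c.bentPath p d e f n) i =
    if c.pos p - d ≤ i ∧ i < c.pos p - 2 * d + n then f i
    else if c.pos p - min n d ≤ i ∧ i < c.pos p then e i else c.lamp p i := by
  simp [bentPath, patch_apply]

theorem bentPath_zero : c.bentPath p d e f 0 = p := by
  refine c.ext_vertex (by simp [pos_bentPath]) (fun i => ?_)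
  rw [lamp_bentPath, if_neg (by push_cast; omega), if_neg (by push_cast; omega)]

theorem bentPath_adj (n : ℕ) : DL.Adj (c.bentPath p d e f n) (c.bentPath p d e f (n + 1)) := by
  rcases Nat.lt_or_ge n d with h | h
  · refine (adj_of_up (c := c) ?_ (fun i hi => ?_)).symm
    · rw [pos_bentPath, pos_bentPath]; push_cast; omega
    · rw [pos_bentPath] at hi
      push_cast at hi
      have h0 : ¬(c.pos p - d ≤ i ∧ i < c.pos p - 2 * d + n) := by omega
      have h1 : ¬(c.pos p - d ≤ i ∧ i < c.pos p - 2 * d + (n + 1 : ℕ)) := by push_cast; omega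
      rw [lamp_bentPath, lamp_bentPath, if_neg h0, if_neg h1]
      congr 1
      push_cast
      apply propext
      constructor <;> rintro ⟨h1, h2⟩ <;> constructor <;> omega
  · refine adj_of_up (c := c) ?_ (fun i hi => ?_)
    · rw [pos_bentPath, pos_bentPath]; push_cast; omega
    · rw [pos_bentPath] at hi
      rw [lamp_bentPath, lamp_bentPath]
      push_cast
      congr 1
      · apply propext
        constructor <;> rintro ⟨h1, h2⟩ <;> constructor <;> omega
      · congr 1
        apply propext
        constructor <;> rintro ⟨h1, h2⟩ <;> constructor <;> omega

/-- The path with one turn is a geodesic ray, as a lamp is changed at the turn. -/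
def bentRay (c : Chart) (p : DLVertex) (d : ℕ) (e f : ℤ → ZMod 2)
    (hd : 0 < d → f (c.pos p - d) ≠ c.lamp p (c.pos p - d)) : GeodRay DL :=
  ⟨c.bentPath p d e f, fun m n hmn => by
    apply le_antisymm
    · induction n, hmn using Nat.le_induction with
      | base => simp
      | succ n hmn ih =>
        calc DL.edist (c.bentPath p d e f m) (c.bentPath p d e f (n + 1))
            ≤ DL.edist (c.bentPath p d e f m) (c.bentPath p d e f n) +
              DL.edist (c.bentPath p d e f n) (c.bentPath p d e f (n + 1)) :=
              SimpleGraph.edist_triangle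
          _ ≤ ((n - m : ℕ) : ℕ∞) + 1 :=
              add_le_add ih (SimpleGraph.edist_eq_one_iff_adj.2 (bentPath_adj n)).le
          _ = _ := by norm_cast; omega
    · refine SimpleGraph.le_edist_of_forall_walk (fun q => ?_)
      have h1 := c.pos_sub_le_length q
      have h2 := c.sub_pos_le_length q
      rw [pos_bentPath, pos_bentPath] at h1 h2
      rcases Nat.lt_or_ge m d with hm | hm
      · rcases Nat.lt_or_ge d n with hn | hn
        · have := add_pos_le_length (c := c) q (m := c.pos p - d) (by
            rw [lamp_bentPath, lamp_bentPath, if_neg (by omega), if_neg (by omega),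
              if_pos (by constructor <;> omega)]
            exact (hd (by omega)).symm)
          rw [pos_bentPath, pos_bentPath] at this
          omega
        · omega
      · omega⟩

theorem bentRay_rayTo (hd : 0 < d → f (c.pos p - d) ≠ c.lamp p (c.pos p - d))
    (hf : ∀ i < c.pos p - d, f i = c.lamp p i) : c.RayTo (c.bentRay p d e f hd) d f where
  pos n := by
    change c.pos (c.bentPath p d e f n) = c.pos (c.bentPath p d e f 0) + _ - _
    rw [pos_bentPath, bentPath_zero]
  lamp n hn i hi := by
    change c.lamp (c.bentPath p d e f n) i = f i
    change i < c.pos (c.bentPath p d e f n) at hi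
    rw [pos_bentPath] at hi
    rw [lamp_bentPath]
    by_cases h : i < c.pos p - d
    · rw [if_neg (by omega), if_neg (by omega), hf i h]
    · rw [if_pos (by constructor <;> omega)]

/-- The depth to which a ray from `p` has to go down to reach `f`. -/
theorem exists_depth (p : DLVertex) (hf : ∃ B : ℤ, ∀ i < B, f i = 0) :
    ∃ d : ℕ, (∀ i < c.pos p - d, f i = c.lamp p i) ∧
      (0 < d → f (c.pos p - d) ≠ c.lamp p (c.pos p - d)) := by
  have hex : ∃ d : ℕ, ∀ i < c.pos p - d, f i = c.lamp p i := by
    obtain ⟨B, hB⟩ := hf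
    obtain ⟨B', hB'⟩ := (c.lamp p).hasFiniteSupport.bddBelow
    refine ⟨(c.pos p - min B B').toNat, fun i hi => ?_⟩
    rw [hB i (by omega)]
    by_contra hne
    have := hB' (Function.mem_support.2 (Ne.symm hne))
    omega
  classical
  refine ⟨Nat.find hex, Nat.find_spec hex, fun hd heq => ?_⟩
  refine Nat.find_min hex (m := Nat.find hex - 1) (by omega) (fun i hi => ?_)
  rcases eq_or_ne i (c.pos p - Nat.find hex) with rfl | hne
  · exact heq
  · exact Nat.find_spec hex i (by omega)

end Chart

/-! ### Open sets of the based topologies -/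

section Based

variable {V : Type*} {G : SimpleGraph V}

theorem GeodRay.isOpen_cylinder (γ : GeodRay G) (N : ℕ) :
    IsOpen {γ' : GeodRay G | ∀ n ≤ N, γ' n = γ n} := by
  let _ : TopologicalSpace V := ⊥
  refine isOpen_induced_iff.2 ⟨⋂ n ∈ Set.Iic N, {x : ℕ → V | x n = γ n}, ?_, ?_⟩
  · refine (Set.finite_Iic N).isOpen_biInter fun n _ => ?_
    have hd : IsOpen {γ n} := trivial
    have hc : Continuous fun x : ℕ → V => x n := continuous_apply n
    exact hd.preimage hc
  · ext γ'
    simp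

theorem GeodRay.exists_cylinder {s : Set (GeodRay G)} (hs : IsOpen s) {γ : GeodRay G}
    (hγ : γ ∈ s) : ∃ N : ℕ, ∀ γ' : GeodRay G, (∀ n ≤ N, γ' n = γ n) → γ' ∈ s := by
  let _ : TopologicalSpace V := ⊥
  obtain ⟨t, ht, rfl⟩ := isOpen_induced_iff.1 hs
  obtain ⟨I, u, hu, hsub⟩ := isOpen_pi_iff.1 ht _ hγ
  refine ⟨I.sup id, fun γ' h => hsub fun n hn => ?_⟩
  change γ' n ∈ u n
  rw [h n (Finset.le_sup (f := id) hn)]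
  exact (hu n hn).2

theorem VisualBoundary.isOpen_based_iff {p : V} {U : Set (VisualBoundary G)} :
    IsOpen[VisualBoundary.based G p] U ↔ ∀ γ : GeodRay G, γ 0 = p → γ.cls ∈ U →
      ∃ N : ℕ, ∀ γ' : GeodRay G, γ' 0 = p → (∀ n ≤ N, γ' n = γ n) → γ'.cls ∈ U := by
  rw [isOpen_coinduced]
  constructor
  · intro h γ h0 hγ
    obtain ⟨t, ht, hpre⟩ := isOpen_induced_iff.1 h
    have hmem : ∀ γ' : GeodRay G, γ' 0 = p → (γ' ∈ t ↔ γ'.cls ∈ U) := fun γ' h' =>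
      Set.ext_iff.1 hpre ⟨γ', h'⟩
    obtain ⟨N, hN⟩ := GeodRay.exists_cylinder ht ((hmem γ h0).2 hγ)
    exact ⟨N, fun γ' h' hn => (hmem γ' h').1 (hN γ' hn)⟩
  · intro h
    refine isOpen_iff_forall_mem_open.2 fun γ hγ => ?_
    obtain ⟨N, hN⟩ := h γ.1 γ.2 hγ
    exact ⟨Subtype.val ⁻¹' {γ' : GeodRay G | ∀ n ≤ N, γ' n = γ.1 n},
      fun γ' hγ' => hN γ'.1 γ'.2 hγ',
      (GeodRay.isOpen_cylinder γ.1 N).preimage continuous_subtype_val, fun n _ => rfl⟩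

theorem VisualBoundary.based_le_unbased (p : V) :
    VisualBoundary.based G p ≤ VisualBoundary.unbased G := by
  intro U hU
  rw [VisualBoundary.isOpen_based_iff]
  intro γ _ hγ
  obtain ⟨N, hN⟩ := GeodRay.exists_cylinder (isOpen_coinduced.1 hU) hγ
  exact ⟨N, fun γ' _ h => hN γ' h⟩

end Based

namespace Chart

variable {c : Chart} {p : DLVertex} {ξ ξ' : Bdry} {f f' : ℤ → ZMod 2} {U : Set Bdry}

/-- The class contains rays that go up eventually, with limit `f` of the lamps. -/
def Represents (c : Chart) (ξ : Bdry) (f : ℤ → ZMod 2) : Prop :=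
  ∃ (γ : GeodRay DL) (d : ℕ), γ.cls = ξ ∧ c.RayTo γ d f

theorem Represents.cls_unique (h : c.Represents ξ f) (h' : c.Represents ξ' f) : ξ = ξ' := by
  obtain ⟨γ, d, rfl, hγ⟩ := h
  obtain ⟨γ', d', rfl, hγ'⟩ := h'
  exact hγ.cls_eq hγ'

theorem Represents.limit_unique (h : c.Represents ξ f) (h' : c.Represents ξ f') : f = f' := by
  obtain ⟨γ, d, rfl, hγ⟩ := h
  obtain ⟨γ', d', e, hγ'⟩ := h'
  exact hγ.limit_unique hγ' e.symm

theorem Represents.not_opp (h : c.Represents ξ f) : ¬c.opp.Represents ξ f' := by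
  rintro ⟨γ', d', e, hγ'⟩
  obtain ⟨γ, d, rfl, hγ⟩ := h
  exact hγ.not_opp hγ' e.symm

theorem RayTo.represents {γ : GeodRay DL} {d : ℕ} (h : c.RayTo γ d f) : c.Represents γ.cls f :=
  ⟨γ, d, rfl, h⟩

theorem Represents.rayTo (h : c.Represents ξ f) {γ : GeodRay DL} (hγ : γ.cls = ξ) :
    ∃ d, c.RayTo γ d f := by
  obtain ⟨γ', d', rfl, hγ'⟩ := h
  exact hγ'.exists_of_cls_eq hγ.symm

theorem exists_represents (c : Chart) (ξ : Bdry) :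
    (∃ f, c.Represents ξ f) ∨ ∃ f, c.opp.Represents ξ f := by
  obtain ⟨γ, rfl⟩ := Quotient.exists_rep ξ
  rcases c.exists_rayTo γ with ⟨d, f, h⟩ | ⟨d, f, h⟩
  · exact Or.inl ⟨f, γ, d, rfl, h⟩
  · exact Or.inr ⟨f, γ, d, rfl, h⟩

theorem Represents.eq_zero (h : c.Represents ξ f) : ∃ B : ℤ, ∀ i < B, f i = 0 := by
  obtain ⟨γ, d, rfl, hγ⟩ := h
  obtain ⟨B, hB⟩ := (c.lamp (γ 0)).hasFiniteSupport.bddBelow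
  refine ⟨min B (c.pos (γ 0) - d), fun i hi => ?_⟩
  rw [hγ.lamp_start (by omega)]
  by_contra hne
  have := hB (Function.mem_support.2 hne)
  omega

theorem exists_represents_of_eq_zero (c : Chart) (hf : ∃ B : ℤ, ∀ i < B, f i = 0) :
    ∃ ξ, c.Represents ξ f := by
  obtain ⟨d, h1, h2⟩ := exists_depth (c := c) (c.vertex 0 0) hf
  exact ⟨_, c.bentRay _ d 0 f h2, d, rfl, bentRay_rayTo h2 h1⟩

/-- The class is represented by a ray from `p` that only goes up. -/
theorem Represents.exists_turnless (h : c.Represents ξ f) (hf : ∀ i < c.pos p, f i = c.lamp p i) :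
    ∃ γ : GeodRay DL, γ.cls = ξ ∧ γ 0 = p ∧ c.RayTo γ 0 f := by
  have hr : c.RayTo (c.bentRay p 0 0 f (by simp)) 0 f := bentRay_rayTo _ (by simpa using hf)
  exact ⟨_, hr.represents.cls_unique h, bentPath_zero, hr⟩

theorem Represents.exists_mem_of_isOpen (hξ : c.Represents ξ f)
    (hU : IsOpen[VisualBoundary.based DL p] U) (hmem : ξ ∈ U) :
    ∃ B : ℤ, ∀ ξ' f', c.Represents ξ' f' → (∀ i < B, f' i = f i) → ξ' ∈ U := by
  rw [VisualBoundary.isOpen_based_iff] at hU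
  obtain ⟨d, h1, h2⟩ := exists_depth (c := c) p hξ.eq_zero
  have hr : c.RayTo (c.bentRay p d 0 f h2) d f := bentRay_rayTo h2 h1
  obtain ⟨N, hN⟩ := hU (c.bentRay p d 0 f h2) bentPath_zero (by
    rwa [hr.represents.cls_unique hξ])
  refine ⟨max (c.pos p - d + 1) (c.pos p - 2 * d + N), fun ξ' f' h' hf => ?_⟩
  have h2' : 0 < d → f' (c.pos p - d) ≠ c.lamp p (c.pos p - d) := by
    rw [hf _ (by omega)]
    exact h2
  have hr' : c.RayTo (c.bentRay p d 0 f' h2') d f' := bentRay_rayTo h2' fun i hi => by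
    rw [hf _ (by omega), h1 i hi]
  rw [← hr'.represents.cls_unique h']
  refine hN _ bentPath_zero fun n hn => ?_
  refine c.ext_vertex (by simp only [bentRay, pos_bentPath]) (fun i => ?_)
  simp only [bentRay, lamp_bentPath]
  split_ifs with h
  · exact hf i (by omega)
  all_goals rfl

/-- A neighborhood of a class that is reached from `p` without turns contains all the classes that
are reached from `p` by rays with a late turn. -/
theorem Represents.exists_opp_mem_of_isOpen (hξ : c.Represents ξ f)
    (hf : ∀ i < c.pos p, f i = c.lamp p i)
    (hU : IsOpen[VisualBoundary.based DL p] U) (hmem : ξ ∈ U) :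
    ∃ B : ℤ, ∀ ξ' f', c.opp.Represents ξ' f' → (∃ i < B, f' i ≠ c.opp.lamp p i) → ξ' ∈ U := by
  rw [VisualBoundary.isOpen_based_iff] at hU
  have h2 : 0 < 0 → f (c.pos p - (0 : ℕ)) ≠ c.lamp p (c.pos p - (0 : ℕ)) := by simp
  have hr : c.RayTo (c.bentRay p 0 0 f h2) 0 f := bentRay_rayTo h2 (by simpa using hf)
  obtain ⟨N, hN⟩ := hU (c.bentRay p 0 0 f h2) bentPath_zero (by
    rwa [hr.represents.cls_unique hξ])
  refine ⟨c.opp.pos p - N, fun ξ' f' h' ⟨i, hi, hne⟩ => ?_⟩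
  obtain ⟨d, h1', h2'⟩ := exists_depth (c := c.opp) p h'.eq_zero
  have hr' : c.opp.RayTo (c.opp.bentRay p d (fun i => f (-1 - i)) f' h2') d f' :=
    bentRay_rayTo h2' h1'
  have hd : N < d := by
    by_contra hle
    exact hne (h1' i (by omega))
  rw [← hr'.represents.cls_unique h']
  refine hN _ bentPath_zero fun n hn => ?_
  have hp : c.opp.pos (c.opp.bentPath p d (fun i => f (-1 - i)) f' n) = c.opp.pos p - n := by
    rw [pos_bentPath]
    omega
  refine c.ext_vertex ?_ (fun i => ?_)
  · rw [opp_pos, opp_pos] at hp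
    simp only [bentRay, pos_bentPath]
    push_cast
    omega
  · have hl := lamp_bentPath (c := c.opp) (p := p) (d := d) (e := fun i => f (-1 - i)) (f := f')
      n (-1 - i)
    rw [if_neg (by omega), opp_lamp, opp_lamp, opp_pos,
      show -1 - (-1 - i) = i by ring] at hl
    simp only [bentRay]
    rw [hl, lamp_bentPath]
    push_cast
    by_cases h : c.pos p ≤ i ∧ i < c.pos p + n
    · rw [if_pos (by omega), if_pos (by omega)]
    · rw [if_neg (by omega), if_neg (by omega), if_neg (by omega)]

/-- The classes whose rays from `p` go down and then follow the same lamps up to the height of `p`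
form an open set. -/
theorem isOpen_cylinder (hne : ∃ i < c.pos p, f i ≠ c.lamp p i) :
    IsOpen[VisualBoundary.based DL p]
      {ξ : Bdry | ∃ f', c.Represents ξ f' ∧ ∀ i < c.pos p, f' i = f i} := by
  rw [VisualBoundary.isOpen_based_iff]
  rintro γ h0 ⟨f', h', hf'⟩
  obtain ⟨i, hi, hne⟩ := hne
  obtain ⟨d, hd⟩ := h'.rayTo rfl
  have hpos : 0 < d := by
    by_contra hz
    apply hne
    rw [← hf' i hi, hd.lamp_start (by rw [h0]; omega), h0]
  refine ⟨2 * d + 1, fun γ' h0' hγ' => ?_⟩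
  have e1 := hd.pos d
  have e2 := hd.pos (d + 1)
  have e3 := hd.pos (2 * d + 1)
  rw [← hγ' d (by omega), h0] at e1
  rw [← hγ' (d + 1) (by omega), h0] at e2
  push_cast at e1 e2 e3
  rcases c.exists_rayTo γ' with ⟨d', f'', h''⟩ | ⟨d', f'', h''⟩
  · refine ⟨f'', ⟨γ', d', rfl, h''⟩, fun j hj => ?_⟩
    have e4 := h''.pos d
    have e5 := h''.pos (d + 1)
    rw [h0'] at e4 e5
    push_cast at e5
    rw [← hf' j hj, ← hd.lamp (2 * d + 1) (by omega) j (by rw [e3, h0]; omega),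
      ← hγ' _ le_rfl, h''.lamp (2 * d + 1) (by omega) j (by
        rw [hγ' _ le_rfl, e3, h0]; omega)]
  · have e4 := h''.pos d
    have e5 := h''.pos (d + 1)
    rw [h0'] at e4 e5
    simp only [opp_pos] at e4 e5
    push_cast at e5
    omega

end Chart

/-! ### Projections to the trees -/

namespace L2

/-- The vertex of the tree recorded by the lamps to the left of the lamplighter. -/
def lowerTree (g : L2) : TreeVertex :=
  ⟨g.pos, g.lamps.filter (· < g.pos), fun _ hi => Finsupp.filter_apply_neg _ _ (not_lt.mpr hi)⟩

@[simp] theorem lowerTree_height (g : L2) : g.lowerTree.height = g.pos := rfl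

theorem lowerTree_label (g : L2) (i : ℤ) :
    g.lowerTree.label i = if i < g.pos then g.lamps i else 0 :=
  Finsupp.filter_apply _ _ _

theorem UpStep.lowerTree_eq {g h : L2} (H : UpStep g h) : g.lowerTree = h.lowerTree.pred := by
  obtain ⟨hp, hl⟩ := H
  ext i
  · simp [TreeVertex.pred, hp]
  · simp only [TreeVertex.pred, lowerTree_height, Finsupp.erase_apply, lowerTree_label]
    by_cases h1 : i < g.pos
    · rw [if_pos h1, if_neg (by omega), if_pos (by omega), hl i (by omega)]
    · rw [if_neg h1]
      split_ifs
      · rfl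
      · omega
      · rfl

end L2

theorem tree_height_sub_le {v w : TreeVertex} {n : ℕ} (h : tree.edist v w ≤ n) :
    v.height - w.height ≤ n := by
  obtain ⟨q, hq⟩ := SimpleGraph.exists_walk_of_edist_le h
  have := tree_walk_height q
  omega

theorem tree_edist_zero_le (j k : ℤ) :
    tree.edist (TreeVertex.zero j) (TreeVertex.zero k) ≤ ((j - k).natAbs : ℕ) := by
  rcases le_total k j with h | h
  · obtain ⟨q, hq⟩ : ∃ q : tree.Walk (TreeVertex.zero j) (TreeVertex.zero k),
        q.length = (j - k).natAbs := by
      have := tree_walk_down j (j - k).natAbs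
      rwa [show j - ((j - k).natAbs : ℕ) = k by omega] at this
    rw [← hq]
    exact SimpleGraph.edist_le q
  · obtain ⟨q, hq⟩ : ∃ q : tree.Walk (TreeVertex.zero k) (TreeVertex.zero j),
        q.length = (j - k).natAbs := by
      have := tree_walk_down k (j - k).natAbs
      rwa [show k - ((j - k).natAbs : ℕ) = j by omega] at this
    rw [← hq, SimpleGraph.edist_comm]
    exact SimpleGraph.edist_le q

/-- Paths in the tree with strictly monotone heights are geodesic rays. -/
theorem exists_treeRay {x : ℕ → TreeVertex} (hx : ∀ n, tree.Adj (x n) (x (n + 1)))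
    (hh : (∀ n : ℕ, (x n).height = (x 0).height + n) ∨ ∀ n : ℕ, (x n).height = (x 0).height - n) :
    ∃ ρ : GeodRay tree, ∀ n, ρ n = x n := by
  refine ⟨⟨x, fun m n hmn => le_antisymm ?_ ?_⟩, fun n => rfl⟩
  · induction n, hmn using Nat.le_induction with
    | base => simp
    | succ n hmn ih =>
      calc tree.edist (x m) (x (n + 1)) ≤ tree.edist (x m) (x n) + tree.edist (x n) (x (n + 1)) :=
            SimpleGraph.edist_triangle
        _ ≤ ((n - m : ℕ) : ℕ∞) + 1 :=
            add_le_add ih (SimpleGraph.edist_eq_one_iff_adj.2 (hx n)).le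
        _ = _ := by norm_cast; omega
  · refine SimpleGraph.le_edist_of_forall_walk fun q => ?_
    have h1 := tree_walk_height q
    have h2 := tree_walk_height q.reverse
    rw [SimpleGraph.Walk.length_reverse] at h2
    rcases hh with hh | hh <;>
    · rw [hh m, hh n] at h1 h2
      omega

namespace Chart

variable {c : Chart} {ξ : Bdry} {f : ℤ → ZMod 2} {p : DLVertex}

theorem std_lowerTree (v : DLVertex) : (std.coord v).lowerTree = v.x₀ := by
  obtain ⟨g, rfl⟩ := vertexEquiv.surjective v
  change (vertexEquiv.symm (vertexEquiv g)).lowerTree = _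
  rw [Equiv.symm_apply_apply]
  rfl

theorem std_opp_lowerTree (v : DLVertex) : (std.opp.coord v).lowerTree = v.x₁ := by
  obtain ⟨g, rfl⟩ := vertexEquiv.surjective v
  change (mirror (vertexEquiv.symm (vertexEquiv g))).lowerTree = _
  rw [Equiv.symm_apply_apply]
  ext i
  · rfl
  · rw [lowerTree_label]
    simp only [vertexEquiv, Equiv.coe_fn_mk, reflect_apply, Finsupp.filter_apply, mirror_pos,
      mirror_lamps]
    congr 1
    apply propext
    omega

theorem coord_upStep {v w : DLVertex} (h : DL.Adj v w) (hp : c.pos w = c.pos v + 1) :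
    UpStep (c.coord v) (c.coord w) := by
  rcases (c.adj_iff v w).1 h with h | h
  · exact h
  · have := h.1
    simp only [pos] at hp
    omega

theorem Represents.exists_approaches (h : c.Represents ξ f) : ∃ γ : GeodRay DL, γ.cls = ξ ∧
    (∃ e, e ≠ omegaEnd ∧ ApproachesEnd (fun n => (c.coord (γ n)).lowerTree) e) ∧
      ApproachesEnd (fun n => (c.opp.coord (γ n)).lowerTree) omegaEnd := by
  obtain ⟨γ, d, rfl, hγ⟩ := h
  have hpos : ∀ n : ℕ, (c.coord (γ n)).pos = c.pos (γ 0) + n - 2 * min n d := hγ.pos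
  have hup : ∀ n, d ≤ n → UpStep (c.coord (γ n)) (c.coord (γ (n + 1))) := fun n hn =>
    coord_upStep (γ.adj n) (by rw [hγ.pos, hγ.pos n]; push_cast; omega)
  refine ⟨γ, rfl, ?_, ?_⟩
  · obtain ⟨ρ, hρ⟩ := exists_treeRay (x := fun n => (c.coord (γ (d + n))).lowerTree)
      (fun n => Or.inl (hup (d + n) (by omega)).lowerTree_eq)
      (Or.inl fun n => by
        simp only [lowerTree_height, hpos]
        push_cast
        omega)
    refine ⟨ρ.cls, fun he => ?_, d, ρ, rfl, fun n => (hρ n).symm⟩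
    obtain ⟨C, hC⟩ := GeodRay.cls_eq_iff.1 he
    have h1 := tree_height_sub_le (hC (C + d + (- c.pos (γ 0)).toNat + 1))
    rw [hρ] at h1
    change (c.coord (γ _)).pos - (-((_ : ℕ) : ℤ)) ≤ _ at h1
    rw [hpos] at h1
    push_cast at h1
    omega
  · obtain ⟨B, hB⟩ := (c.lamp (γ 0)).hasFiniteSupport.bddAbove
    obtain ⟨N, hN⟩ : ∃ N : ℕ, N = 2 * d + (B - c.pos (γ 0) + 1).toNat := ⟨_, rfl⟩
    have hzero : ∀ n, N ≤ n → (c.opp.coord (γ n)).lowerTree = TreeVertex.zero (-c.pos (γ n)) := by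
      intro n hn
      ext i
      · rfl
      · rw [lowerTree_label]
        change (if i < c.opp.pos (γ n) then c.opp.lamp (γ n) i else 0) = 0
        rw [opp_pos, opp_lamp]
        split_ifs with hi
        · have e := hγ.pos n
          rw [hγ.lamp_above (by omega) (by omega)]
          by_contra hne
          have := hB (Function.mem_support.2 hne)
          omega
        · rfl
    obtain ⟨ρ, hρ⟩ := exists_treeRay (x := fun n => TreeVertex.zero (-c.pos (γ (N + n))))
      (fun n => by
        right
        rw [TreeVertex.pred_zero]
        congr 1
        rw [← add_assoc, hγ.pos (N + n), hγ.pos (N + n + 1)]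
        push_cast
        omega)
      (Or.inr fun n => by
        simp only [TreeVertex.zero]
        rw [hγ.pos (N + n), hγ.pos (N + 0)]
        push_cast
        omega)
    refine ⟨N, ρ, ?_, fun n => by rw [hρ]; exact hzero _ (by omega)⟩
    refine GeodRay.cls_eq_iff.2 ⟨(c.pos (γ N)).natAbs, fun n => ?_⟩
    rw [hρ]
    refine (tree_edist_zero_le _ _).trans ?_
    rw [hγ.pos (N + n), hγ.pos N]
    push_cast
    norm_cast
    omega

theorem exists_represents_of_approaches {γ : GeodRay DL}
    (h : ApproachesEnd (fun n => (c.opp.coord (γ n)).lowerTree) omegaEnd) :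
    ∃ f, c.Represents γ.cls f := by
  rcases c.exists_rayTo γ with ⟨d, f, hγ⟩ | ⟨d, f, hγ⟩
  · exact ⟨f, γ, d, rfl, hγ⟩
  · exfalso
    obtain ⟨N, ρ, hρ, hx⟩ := h
    obtain ⟨C, hC⟩ := GeodRay.cls_eq_iff.1 hρ
    have h1 := tree_height_sub_le (hC (C + d + (- c.opp.pos (γ 0)).toNat + 1))
    rw [← hx] at h1
    change c.opp.pos (γ _) - (-((_ : ℕ) : ℤ)) ≤ _ at h1
    rw [hγ.pos] at h1
    push_cast at h1
    omega

theorem mem_bdryPlus_iff : ξ ∈ bdryPlus ↔ ∃ f, std.Represents ξ f := by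
  constructor
  · rintro ⟨γ, rfl, -, h⟩
    exact exists_represents_of_approaches (by simpa only [std_opp_lowerTree] using h)
  · rintro ⟨f, h⟩
    have := h.exists_approaches
    simp only [std_lowerTree, std_opp_lowerTree] at this
    exact this

theorem mem_bdryMinus_iff : ξ ∈ bdryMinus ↔ ∃ f, std.opp.Represents ξ f := by
  constructor
  · rintro ⟨γ, rfl, -, h⟩
    exact exists_represents_of_approaches (by simpa only [opp_opp, std_lowerTree] using h)
  · rintro ⟨f, h⟩
    have := h.exists_approaches
    simp only [opp_opp, std_lowerTree, std_opp_lowerTree] at this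
    exact this

/-! ### Lamp stands and turnless rays -/

theorem represents_iff : c.Represents ξ f ↔ ∃ γ : GeodRay DL, γ.cls = ξ ∧
    (∀ i, ∀ᶠ n in atTop, c.lamp (γ n) i = f i) ∧
      Tendsto (fun n => c.pos (γ n)) atTop atTop := by
  constructor
  · rintro ⟨γ, d, rfl, h⟩
    refine ⟨γ, rfl, fun i => ?_, tendsto_atTop.2 fun b => ?_⟩
    · filter_upwards [eventually_ge_atTop (2 * d + (i - c.pos (γ 0) + 1).toNat)] with n hn
      have := h.pos n
      exact h.lamp n (by omega) i (by omega)
    · filter_upwards [eventually_ge_atTop (2 * d + (b - c.pos (γ 0)).toNat)] with n hn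
      have := h.pos n
      omega
  · rintro ⟨γ, rfl, hl, hp⟩
    rcases c.exists_rayTo γ with ⟨d, f', h⟩ | ⟨d, f', h⟩
    · refine ⟨γ, d, rfl, ?_⟩
      convert h using 1
      funext i
      obtain ⟨n, h1, h2, h3⟩ := ((hl i).and ((eventually_ge_atTop d).and
        (hp.eventually_gt_atTop i))).exists
      rw [← h1, h.lamp n h2 i h3]
    · exfalso
      obtain ⟨n, h1, h2⟩ := ((eventually_ge_atTop (2 * d)).and
        (hp.eventually_gt_atTop (c.pos (γ 0)))).exists
      have := h.pos n
      simp only [opp_pos] at this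
      omega

theorem hasLampStand_atTop_iff : HasLampStand ξ f atTop ↔ std.Represents ξ f :=
  (represents_iff (c := std)).symm

theorem hasLampStand_atBot_iff :
    HasLampStand ξ f atBot ↔ std.opp.Represents ξ fun i => f (-1 - i) := by
  rw [represents_iff]
  refine exists_congr fun γ => and_congr_right fun _ => and_congr ?_ ?_
  · simp only [opp_lamp]
    refine ⟨fun h i => h (-1 - i), fun h i => ?_⟩
    have := h (-1 - i)
    rwa [show -1 - (-1 - i) = i by ring] at this
  · simp only [opp_pos]
    exact tendsto_neg_atTop_iff.symm

theorem Represents.turnless_iff (h : c.Represents ξ f) :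
    (∃ γ : GeodRay DL, γ.cls = ξ ∧ γ 0 = p ∧ ((∀ n, c.pos (γ (n + 1)) = c.pos (γ n) + 1) ∨
      ∀ n, c.pos (γ (n + 1)) = c.pos (γ n) - 1)) ↔ ∀ i < c.pos p, f i = c.lamp p i := by
  constructor
  · rintro ⟨γ, hγ, rfl, hm⟩ i hi
    obtain ⟨d, hd⟩ := h.rayTo hγ
    refine hd.lamp_start ?_
    have e0 := hd.pos 1
    have e1 := hd.pos d
    have e2 := hd.pos (d + 1)
    push_cast at e0 e2
    rcases hm with hm | hm
    · have := hm 0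
      simp only [zero_add] at this
      omega
    · have := hm d
      omega
  · intro hf
    obtain ⟨γ, h1, h2, h3⟩ := h.exists_turnless hf
    refine ⟨γ, h1, h2, Or.inl fun n => ?_⟩
    have := h3.pos n
    have := h3.pos (n + 1)
    push_cast at this
    omega

theorem hasTurnlessRay_iff (h : std.Represents ξ f) :
    HasTurnlessRay p ξ ↔ ∀ i < std.pos p, f i = std.lamp p i :=
  h.turnless_iff

theorem hasTurnlessRay_iff_opp (h : std.opp.Represents ξ f) :
    HasTurnlessRay p ξ ↔ ∀ i < std.opp.pos p, f i = std.opp.lamp p i := by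
  rw [← h.turnless_iff]
  refine exists_congr fun γ => and_congr_right fun _ => and_congr_right fun _ => ?_
  rw [or_comm]
  have e : ∀ v : DLVertex, v.x₀.height = -std.opp.pos v := fun v => by
    rw [opp_pos, neg_neg]
    rfl
  simp only [e]
  refine or_congr (forall_congr' fun n => ?_) (forall_congr' fun n => ?_) <;> omega

end Chart

/-! ### The action on the boundary -/

/-- North-south dynamics for a topology implies it for all coarser ones. -/
theorem NorthSouth.mono {τ τ' : TopologicalSpace Bdry} (hτ : τ ≤ τ') {g : L2} {α ρ : Bdry}
    (h : NorthSouth τ g α ρ) : NorthSouth τ' g α ρ := by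
  obtain ⟨h1, h2, h3, h4, h5, h6⟩ := h
  exact ⟨h1, h2, h3, fun ξ hξ => (h4 ξ hξ).mono_right (nhds_mono hτ),
    fun ξ hξ => (h5 ξ hξ).mono_right (nhds_mono hτ),
    fun U V hU hV => h6 U V (hτ U hU) (hτ V hV)⟩

theorem NorthSouth.inv {τ : TopologicalSpace Bdry} {g : L2} {α ρ : Bdry}
    (h : NorthSouth τ g α ρ) : NorthSouth τ g⁻¹ ρ α := by
  obtain ⟨h1, h2, h3, h4, h5, h6⟩ := h
  refine ⟨h1.symm, inv_smul_eq_iff.2 h3.symm, inv_smul_eq_iff.2 h2.symm, h5, by rwa [inv_inv],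
    fun U V hU hV hρ hα => ?_⟩
  obtain ⟨N, hN⟩ := h6 V U hV hU hα hρ
  exact ⟨N, fun n hn => ⟨(hN n hn).2, by rw [inv_inv]; exact (hN n hn).1⟩⟩

theorem HalfAttraction.inv {g : L2} {α ρ : Bdry} {A R : Set Bdry}
    (h : HalfAttraction g α ρ A R) : HalfAttraction g⁻¹ ρ α R A := by
  obtain ⟨h1, h2, h3⟩ := h
  exact ⟨h2, h1, fun p => ⟨(h3 p).2, by rw [inv_inv]; exact (h3 p).1⟩⟩

namespace Chart

variable {c : Chart} {ξ : Bdry} {f x : ℤ → ZMod 2} {g h : L2}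

/-- In the chart, the element `g` acts as left multiplication by `h`. -/
def ActsAs (c : Chart) (g h : L2) : Prop := ∀ v, c.coord (g.toIso v) = h * c.coord v

theorem std_actsAs (g : L2) : std.ActsAs g g := fun v => by simp [std, toIso]

theorem ActsAs.opp (H : c.ActsAs g h) : c.opp.ActsAs g (mirror h) := fun v => by
  change mirror (c.coord (g.toIso v)) = mirror h * mirror (c.coord v)
  rw [H v, map_mul]

theorem ActsAs.inv (H : c.ActsAs g h) : c.ActsAs g⁻¹ h⁻¹ := fun v => by
  have h1 := H (g⁻¹.toIso v)
  have h2 : g.toIso (g⁻¹.toIso v) = v := by simp [toIso]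
  rw [h2] at h1
  rw [h1, inv_mul_cancel_left]

theorem Represents.smul (H : c.ActsAs g h) (hξ : c.Represents ξ f) :
    c.Represents (g • ξ) fun i => h.lamps i + f (i - h.pos) := by
  obtain ⟨γ, d, rfl, hγ⟩ := hξ
  have hp : ∀ v, c.pos (g.toIso v) = h.pos + c.pos v := fun v => by simp [pos, H v]
  have hl : ∀ v i, c.lamp (g.toIso v) i = h.lamps i + c.lamp v (i - h.pos) := fun v i => by
    simp [lamp, H v]
  refine ⟨GeodRay.map g.toIso γ, d, rfl, fun n => ?_, fun n hn i hi => ?_⟩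
  · change c.pos (g.toIso (γ n)) = c.pos (g.toIso (γ 0)) + _ - _
    rw [hp, hp, hγ.pos]
    ring
  · change i < c.pos (g.toIso (γ n)) at hi
    rw [hp] at hi
    change c.lamp (g.toIso (γ n)) i = _
    rw [hl, hγ.lamp n hn _ (by omega)]

/-- If the lamps `f` are fixed, the powers of `g` shift the difference to `f`. -/
theorem Represents.pow_smul (H : c.ActsAs g h) (hf : ∀ i, f i = h.lamps i + f (i - h.pos))
    (hξ : c.Represents ξ x) (n : ℕ) :
    c.Represents (g ^ n • ξ) fun i => f i + (x (i - n * h.pos) - f (i - n * h.pos)) := by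
  induction n with
  | zero => simpa using hξ
  | succ n ih =>
    rw [pow_succ', mul_smul]
    convert ih.smul H using 1
    funext i
    rw [← add_assoc, ← hf i]
    congr 3 <;> push_cast <;> ring

end Chart

namespace L2

theorem lamps_fixed_inv {h : L2} {f : ℤ → ZMod 2} (hf : ∀ i, f i = h.lamps i + f (i - h.pos))
    (i : ℤ) : f i = h⁻¹.lamps i + f (i - h⁻¹.pos) := by
  have := hf (i + h.pos)
  rw [add_sub_cancel_right] at this
  simp [this, ← add_assoc, CharTwo.add_self_eq_zero]

/-- The lamps of the powers converge. -/
theorem exists_lamps_limit {h : L2} (hp : 0 < h.pos) : ∃ f : ℤ → ZMod 2,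
    (∀ i, ∀ᶠ n : ℕ in atTop, (h ^ n).lamps i = f i) ∧ (∃ B : ℤ, ∀ i < B, f i = 0) ∧
      ∀ i, f i = h.lamps i + f (i - h.pos) := by
  obtain ⟨S, hS⟩ := h.lamps.hasFiniteSupport.bddBelow
  have hpow : ∀ n : ℕ, (h ^ n).pos = n * h.pos := by
    intro n
    induction n with
    | zero => simp
    | succ n ih => rw [pow_succ, mul_pos, ih]; push_cast; ring
  have hstep : ∀ (n : ℕ) (i : ℤ), i < S + n → (h ^ (n + 1)).lamps i = (h ^ n).lamps i := by
    intro n i hi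
    rw [pow_succ, mul_lamps, Finsupp.add_apply, shift_apply, hpow]
    convert add_zero _
    by_contra hne
    have := hS (Function.mem_support.2 hne)
    nlinarith
  have hconst : ∀ (m n : ℕ) (i : ℤ), m ≤ n → i < S + m →
      (h ^ n).lamps i = (h ^ m).lamps i := by
    intro m n i hmn hi
    induction n, hmn using Nat.le_induction with
    | base => rfl
    | succ n hmn ih => rw [hstep n i (by omega), ih]
  have hlim : ∀ i, ∀ᶠ n : ℕ in atTop, (h ^ n).lamps i = (h ^ (i - S + 1).toNat).lamps i := by
    intro i
    filter_upwards [eventually_ge_atTop (i - S + 1).toNat] with n hn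
    exact hconst _ _ i hn (by omega)
  refine ⟨fun i => (h ^ (i - S + 1).toNat).lamps i, hlim, ⟨S, fun i hi => ?_⟩, fun i => ?_⟩
  · simp [show (i - S + 1).toNat = 0 by omega]
  · obtain ⟨n, h1, h2⟩ := (((tendsto_add_atTop_nat 1).eventually (hlim i)).and
      (hlim (i - h.pos))).exists
    beta_reduce
    rw [← h1, ← h2, pow_succ']
    simp

end L2

/-- The data of an element that moves the lamplighter up in a chart: its action in the chart and
in the opposite one, and its fixed points. -/
structure Dynamics (c : Chart) (g h h' : L2) (α ρ : Bdry) (f f' : ℤ → ZMod 2) : Prop where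
  pos : 0 < h.pos
  pos' : h'.pos < 0
  acts : c.ActsAs g h
  acts' : c.opp.ActsAs g h'
  fixed : ∀ i, f i = h.lamps i + f (i - h.pos)
  fixed' : ∀ i, f' i = h'.lamps i + f' (i - h'.pos)
  rep : c.Represents α f
  rep' : c.opp.Represents ρ f'

namespace Dynamics

open Chart

variable {c : Chart} {g h h' : L2} {α ρ : Bdry} {f f' : ℤ → ZMod 2} {p : DLVertex}
  {U V : Set Bdry}

theorem symm (D : Dynamics c g h h' α ρ f f') : Dynamics c.opp g⁻¹ h'⁻¹ h⁻¹ ρ α f' f where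
  pos := by simpa using D.pos'
  pos' := by simpa using D.pos
  acts := D.acts'.inv
  acts' := by rw [opp_opp]; exact D.acts.inv
  fixed := lamps_fixed_inv D.fixed'
  fixed' := lamps_fixed_inv D.fixed
  rep := D.rep'
  rep' := by rw [opp_opp]; exact D.rep

theorem smul_eq (D : Dynamics c g h h' α ρ f f') : g • α = α := by
  have := D.rep.smul D.acts
  rw [← funext D.fixed] at this
  exact this.cls_unique D.rep

theorem ne (D : Dynamics c g h h' α ρ f f') : α ≠ ρ := by
  rintro rfl
  exact D.rep.not_opp D.rep'

theorem attracts (D : Dynamics c g h h' α ρ f f') (hU : IsOpen[VisualBoundary.based DL p] U)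
    (hα : α ∈ U) (B : ℤ) : ∃ N : ℕ, ∀ n ≥ N, ∀ ξ x, c.Represents ξ x → (∀ i < B, x i = f i) →
      g ^ n • ξ ∈ U := by
  obtain ⟨B', hB'⟩ := D.rep.exists_mem_of_isOpen hU hα
  refine ⟨(B' - B).toNat, fun n hn ξ x hξ hx => ?_⟩
  refine hB' _ _ (hξ.pow_smul D.acts D.fixed n) fun i hi => ?_
  have : (n : ℤ) ≤ n * h.pos := le_mul_of_one_le_right (by omega) D.pos
  rw [hx _ (by omega), sub_self, add_zero]

theorem attracts_opp (D : Dynamics c g h h' α ρ f f') (hf : ∀ i < c.pos p, f i = c.lamp p i)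
    (hf' : ∀ i < c.opp.pos p, f' i = c.opp.lamp p i)
    (hU : IsOpen[VisualBoundary.based DL p] U) (hα : α ∈ U) (B : ℤ) :
    ∃ N : ℕ, ∀ n ≥ N, ∀ ξ y, c.opp.Represents ξ y → (∃ i < B, y i ≠ f' i) → g ^ n • ξ ∈ U := by
  obtain ⟨B', hB'⟩ := D.rep.exists_opp_mem_of_isOpen hf hU hα
  refine ⟨(B - min B' (c.opp.pos p)).toNat, fun n hn ξ y hξ ⟨i, hi, hne⟩ => ?_⟩
  have hn' : (n : ℤ) * h'.pos ≤ -n := by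
    have := D.pos'
    nlinarith
  refine hB' _ _ (hξ.pow_smul D.acts' D.fixed' n) ⟨i + n * h'.pos, by omega, ?_⟩
  rw [← hf' _ (by omega), add_sub_cancel_right]
  simpa [sub_eq_zero] using hne

theorem tendsto_half (D : Dynamics c g h h' α ρ f f') {ξ : Bdry} {x : ℤ → ZMod 2}
    (hξ : c.Represents ξ x) (p : DLVertex) :
    Tendsto (fun n : ℕ => g ^ n • ξ) atTop (@nhds Bdry (VisualBoundary.based DL p) α) := by
  rw [@tendsto_nhds _ (VisualBoundary.based DL p)]
  intro U hU hα
  obtain ⟨B, hB⟩ := hξ.eq_zero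
  obtain ⟨B', hB'⟩ := D.rep.eq_zero
  obtain ⟨N, hN⟩ := D.attracts hU hα (min B B')
  filter_upwards [eventually_ge_atTop N] with n hn
  exact hN n hn ξ x hξ fun i hi => by rw [hB i (by omega), hB' i (by omega)]

theorem tendsto_attractor (D : Dynamics c g h h' α ρ f f')
    (hf : ∀ i < c.pos p, f i = c.lamp p i) (hf' : ∀ i < c.opp.pos p, f' i = c.opp.lamp p i)
    {ξ : Bdry} (hξ : ξ ≠ ρ) :
    Tendsto (fun n : ℕ => g ^ n • ξ) atTop (@nhds Bdry (VisualBoundary.based DL p) α) := by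
  rcases c.exists_represents ξ with ⟨x, hx⟩ | ⟨y, hy⟩
  · exact D.tendsto_half hx p
  · rw [@tendsto_nhds _ (VisualBoundary.based DL p)]
    intro U hU hα
    obtain ⟨i, hi⟩ : ∃ i, y i ≠ f' i := by
      by_contra! hall
      obtain rfl : y = f' := funext hall
      exact hξ (hy.cls_unique D.rep')
    obtain ⟨N, hN⟩ := D.attracts_opp hf hf' hU hα (i + 1)
    filter_upwards [eventually_ge_atTop N] with n hn
    exact hN n hn ξ y hy ⟨i, by omega, hi⟩

theorem uniform (D : Dynamics c g h h' α ρ f f') (hf : ∀ i < c.pos p, f i = c.lamp p i)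
    (hf' : ∀ i < c.opp.pos p, f' i = c.opp.lamp p i)
    (hU : IsOpen[VisualBoundary.based DL p] U) (hV : IsOpen[VisualBoundary.based DL p] V)
    (hα : α ∈ U) (hρ : ρ ∈ V) : ∃ N : ℕ, ∀ n ≥ N, ∀ ξ, ξ ∉ V → g ^ n • ξ ∈ U := by
  obtain ⟨B, hB⟩ := D.rep'.exists_mem_of_isOpen hV hρ
  obtain ⟨B', hB'⟩ := D.rep'.exists_opp_mem_of_isOpen hf' hV hρ
  rw [opp_opp] at hB'
  obtain ⟨N, hN⟩ := D.attracts hU hα (min B' (c.pos p))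
  obtain ⟨N', hN'⟩ := D.attracts_opp hf hf' hU hα B
  refine ⟨max N N', fun n hn ξ hξ => ?_⟩
  rcases c.exists_represents ξ with ⟨x, hx⟩ | ⟨y, hy⟩
  · refine hN n (by omega) ξ x hx fun i hi => ?_
    by_contra hne
    exact hξ (hB' ξ x hx ⟨i, by omega, by rwa [← hf i (by omega)]⟩)
  · refine hN' n (by omega) ξ y hy ?_
    by_contra! hall
    exact hξ (hB ξ y hy hall)

theorem northSouth (D : Dynamics c g h h' α ρ f f') (hf : ∀ i < c.pos p, f i = c.lamp p i)
    (hf' : ∀ i < c.opp.pos p, f' i = c.opp.lamp p i) :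
    NorthSouth (VisualBoundary.based DL p) g α ρ := by
  have hf2 : ∀ i < c.opp.opp.pos p, f i = c.opp.opp.lamp p i := by rwa [opp_opp]
  refine ⟨D.ne, D.smul_eq, (inv_smul_eq_iff.1 D.symm.smul_eq).symm,
    fun ξ => D.tendsto_attractor hf hf', fun ξ => D.symm.tendsto_attractor hf' hf2,
    fun U V hU hV hα hρ => ?_⟩
  obtain ⟨N, hN⟩ := D.uniform hf hf' hU hV hα hρ
  obtain ⟨N', hN'⟩ := D.symm.uniform hf' hf2 hV hU hρ hα
  exact ⟨max N N', fun n hn => ⟨hN n (by omega), hN' n (by omega)⟩⟩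

theorem turnless_of_northSouth (D : Dynamics c g h h' α ρ f f')
    (H : NorthSouth (VisualBoundary.based DL p) g α ρ) : ∀ i < c.pos p, f i = c.lamp p i := by
  by_contra! hne
  obtain ⟨B, hB⟩ := D.rep'.eq_zero
  obtain ⟨ξ, hξ⟩ := c.opp.exists_represents_of_eq_zero
    (f := fun i => f' i + if i = 0 then 1 else 0)
    ⟨min B 0, fun i hi => by rw [hB i (by omega), if_neg (by omega), add_zero]⟩
  have hne' : ξ ≠ ρ := by
    rintro rfl
    have := congrFun (hξ.limit_unique D.rep') 0
    simp at this
  have ht := H.2.2.2.1 ξ hne'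
  rw [@tendsto_nhds _ (VisualBoundary.based DL p)] at ht
  have hev : ∀ᶠ n : ℕ in atTop, ∃ x, c.Represents (g ^ n • ξ) x ∧ ∀ i < c.pos p, x i = f i :=
    ht _ (isOpen_cylinder hne) ⟨f, D.rep, fun _ _ => rfl⟩
  obtain ⟨n, x, hx, -⟩ := hev.exists
  exact hx.not_opp (hξ.pow_smul D.acts' D.fixed' n)

theorem northSouth_iff (D : Dynamics c g h h' α ρ f f') :
    NorthSouth (VisualBoundary.based DL p) g α ρ ↔
      (∀ i < c.pos p, f i = c.lamp p i) ∧ ∀ i < c.opp.pos p, f' i = c.opp.lamp p i :=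
  ⟨fun H => ⟨D.turnless_of_northSouth H, D.symm.turnless_of_northSouth H.inv⟩,
    fun H => D.northSouth H.1 H.2⟩

/-- Some vertex has the lamps of both fixed points. -/
theorem exists_turnless (D : Dynamics c g h h' α ρ f f') : ∃ p,
    (∀ i < c.pos p, f i = c.lamp p i) ∧ ∀ i < c.opp.pos p, f' i = c.opp.lamp p i := by
  obtain ⟨B, hB⟩ := D.rep.eq_zero
  obtain ⟨B', hB'⟩ := D.rep'.eq_zero
  refine ⟨c.vertex (patch (patch 0 B 0 f) 0 (-B') fun i => f' (-1 - i)) 0,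
    fun i hi => ?_, fun i hi => ?_⟩
  · rw [pos_vertex] at hi
    rw [lamp_vertex, patch_apply, if_neg (by omega), patch_apply]
    split_ifs with h1
    · rfl
    · exact hB i (by omega)
  · rw [opp_pos, pos_vertex] at hi
    rw [opp_lamp, lamp_vertex, patch_apply, patch_apply]
    split_ifs with h1 h2
    · rw [show -1 - (-1 - i) = i by ring]
    · omega
    · exact hB' i (by omega)

end Dynamics

namespace L2

open Chart

theorem expT_eq (g : L2) : g.expT = g.pos := rfl

theorem exists_dynamics {g : L2} (hg : 0 < g.pos) : ∃ α ρ f f',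
    Dynamics std g g (mirror g) α ρ f f' ∧ (∀ ξ, IsPowerLimit g ξ ↔ ξ = α) ∧
      ∀ ξ, IsPowerLimit g⁻¹ ξ ↔ ξ = ρ := by
  obtain ⟨f, hlim, h0, hfix⟩ := exists_lamps_limit hg
  obtain ⟨f', hlim', h0', hfix'⟩ := exists_lamps_limit (h := mirror g⁻¹) (by simpa using hg)
  obtain ⟨α, hα⟩ := std.exists_represents_of_eq_zero h0
  obtain ⟨ρ, hρ⟩ := std.opp.exists_represents_of_eq_zero h0'
  refine ⟨α, ρ, f, f', ⟨hg, by simpa using hg, std_actsAs g, (std_actsAs g).opp, hfix, ?_, hα, hρ⟩,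
    fun ξ => ⟨?_, ?_⟩, fun ξ => ⟨?_, ?_⟩⟩
  · have := lamps_fixed_inv hfix'
    rwa [map_inv, inv_inv] at this
  · rintro ⟨f₁, h1, ⟨-, h2⟩ | ⟨h2, -⟩⟩
    · obtain rfl : f₁ = f := funext fun i => by
        obtain ⟨n, e1, e2⟩ := ((h1 i).and (hlim i)).exists
        rw [← e1, e2]
      exact (hasLampStand_atTop_iff.1 h2).cls_unique hα
    · rw [expT_eq] at h2
      omega
  · rintro rfl
    exact ⟨f, hlim, Or.inl ⟨hg, hasLampStand_atTop_iff.2 hα⟩⟩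
  · rintro ⟨f₁, h1, ⟨h2, -⟩ | ⟨-, h2⟩⟩
    · rw [expT_eq, inv_pos] at h2
      omega
    · obtain rfl : (fun i => f₁ (-1 - i)) = f' := funext fun i => by
        obtain ⟨n, e1, e2⟩ := ((h1 (-1 - i)).and (hlim' i)).exists
        rw [← e1, ← e2, ← map_pow, mirror_lamps]
      exact (hasLampStand_atBot_iff.1 h2).cls_unique hρ
  · rintro rfl
    refine ⟨fun i => f' (-1 - i), fun i => ?_, Or.inr ⟨by rw [expT_eq, inv_pos]; omega,
      hasLampStand_atBot_iff.2 (by simpa using hρ)⟩⟩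
    filter_upwards [hlim' (-1 - i)] with n hn
    rw [← hn, ← map_pow, mirror_lamps]
    congr 1
    ring

theorem dynamics_of_pos {g : L2} (hg : 0 < g.pos) : ∃ α ρ : Bdry,
    (∀ ξ, IsPowerLimit g ξ ↔ ξ = α) ∧ (∀ ξ, IsPowerLimit g⁻¹ ξ ↔ ξ = ρ) ∧
    NorthSouth (VisualBoundary.unbased DL) g α ρ ∧ HalfAttraction g α ρ bdryPlus bdryMinus ∧
    (∀ p : DLVertex, NorthSouth (VisualBoundary.based DL p) g α ρ ↔
      HasTurnlessRay p α ∧ HasTurnlessRay p ρ) ∧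
    ∃ p : DLVertex, HasTurnlessRay p α ∧ HasTurnlessRay p ρ := by
  obtain ⟨α, ρ, f, f', D, h1, h2⟩ := exists_dynamics hg
  have hiff : ∀ p : DLVertex, NorthSouth (VisualBoundary.based DL p) g α ρ ↔
      HasTurnlessRay p α ∧ HasTurnlessRay p ρ := fun p => by
    rw [D.northSouth_iff, hasTurnlessRay_iff D.rep, hasTurnlessRay_iff_opp D.rep']
  obtain ⟨p, hp⟩ := D.exists_turnless
  have hNS := D.northSouth_iff.2 hp
  refine ⟨α, ρ, h1, h2, hNS.mono (VisualBoundary.based_le_unbased p), ⟨?_, ?_, fun q => ⟨?_, ?_⟩⟩,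
    hiff, p, (hiff p).1 hNS⟩
  · exact mem_bdryPlus_iff.2 ⟨f, D.rep⟩
  · exact mem_bdryMinus_iff.2 ⟨f', D.rep'⟩
  · intro ξ hξ
    obtain ⟨x, hx⟩ := mem_bdryPlus_iff.1 hξ
    exact D.tendsto_half hx q
  · intro ξ hξ
    obtain ⟨x, hx⟩ := mem_bdryMinus_iff.1 hξ
    exact D.symm.tendsto_half hx q

theorem smul_smul_self {g : L2} (h0 : g.pos = 0) (ξ : Bdry) : g • g • ξ = ξ := by
  have : g * g = 1 := by
    ext i
    · simp [h0, CharTwo.add_self_eq_zero]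
    · simp [h0]
  rw [← mul_smul, this, one_smul]

theorem smul_ne_self {g : L2} (hg : g ≠ 1) (h0 : g.pos = 0) (ξ : Bdry) : g • ξ ≠ ξ := by
  obtain ⟨i, hi⟩ : ∃ i, g.lamps i ≠ 0 := by
    by_contra! hall
    exact hg (L2.ext (Finsupp.ext hall) h0)
  intro he
  rcases std.exists_represents ξ with ⟨f, hf⟩ | ⟨f, hf⟩
  · have h1 := hf.smul (std_actsAs g)
    rw [he] at h1
    have := congrFun (h1.limit_unique hf) i
    simp [h0, hi] at this
  · have h1 := hf.smul (std_actsAs g).opp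
    rw [he] at h1
    have := congrFun (h1.limit_unique hf) (-1 - i)
    simp [h0, hi] at this

end L2

end
theorem theorem4p14 (g : L2) (hg : g ≠ 1) :
    (g.expT = 0 →
      orderOf (MulAction.toPerm g : Equiv.Perm Bdry) = 2 ∧
        ∀ ξ : Bdry, Function.minimalPeriod (fun η : Bdry => g • η) ξ = 2) ∧
    (g.expT ≠ 0 →
      ∃ α ρ : Bdry,
        (∀ ξ, IsPowerLimit g ξ ↔ ξ = α) ∧
        (∀ ξ, IsPowerLimit g⁻¹ ξ ↔ ξ = ρ) ∧
        NorthSouth (VisualBoundary.unbased DL) g α ρ ∧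
        (0 < g.expT → HalfAttraction g α ρ bdryPlus bdryMinus) ∧
        (g.expT < 0 → HalfAttraction g α ρ bdryMinus bdryPlus) ∧
        (∀ p : DLVertex, NorthSouth (VisualBoundary.based DL p) g α ρ ↔
          HasTurnlessRay p α ∧ HasTurnlessRay p ρ) ∧
        (∃ p : DLVertex, HasTurnlessRay p α ∧ HasTurnlessRay p ρ)) := by
  rw [L2.expT_eq]
  refine ⟨fun h0 => ⟨?_, fun ξ => ?_⟩, fun hne => ?_⟩
  · refine orderOf_eq_prime (Equiv.ext fun ξ => ?_) fun h1 => ?_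
    · rw [pow_two]
      exact L2.smul_smul_self h0 ξ
    · obtain ⟨ξ, -⟩ := Chart.std.exists_represents_of_eq_zero (f := 0) ⟨0, fun _ _ => rfl⟩
      exact L2.smul_ne_self hg h0 ξ (Equiv.ext_iff.1 h1 ξ)
  · exact Function.minimalPeriod_eq_prime (L2.smul_smul_self h0 ξ) (L2.smul_ne_self hg h0 ξ)
  · rcases lt_or_gt_of_ne hne with hneg | hpos
    · obtain ⟨ρ, α, h1, h2, h3, h4, h5, p, h6⟩ := L2.dynamics_of_pos (g := g⁻¹) (by simpa using hneg)
      rw [inv_inv] at h2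
      refine ⟨α, ρ, h2, h1, by simpa using h3.inv, fun h => absurd h hneg.not_gt,
        fun _ => by simpa using h4.inv, fun q => ?_, p, h6.symm⟩
      rw [and_comm, ← h5 q]
      exact ⟨NorthSouth.inv, fun h => by simpa using h.inv⟩
    · obtain ⟨α, ρ, h1, h2, h3, h4, h5, h6⟩ := L2.dynamics_of_pos hpos
      exact ⟨α, ρ, h1, h2, h3, fun _ => h4, fun h => absurd h hpos.not_gt, h5, h6⟩
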